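/- **Setting.** Let $Z\in\mathbb R^{m\times n}$ have rank $r$, let $\hat E\subseteq\{1,\dots,m\}\times\{1,\dots,n\}$ be a set of sampled positions, viewed as the edge set of a bipartite graph on the rows and columns, and let $z=\mathcal P_{\hat E}(Z)=(Z_{ij})_{(i,j)\in\hat E}$. The low rank matrix completion problem (LRMC) asks for $M\in\mathbb R^{m\times n}$ with $\mathcal P_{\hat E}(M)=z$ and $\operatorname{rank}(M)\le r$. We say that $\hat E$ has *chain-clique (staircase) structure* if, possibly after exchanging the roles of rows and columns, there are $l\ge 1$ and bicliques $E_i=U_i\times V_i$ $(1\le i\le l)$ with nonempty row sets $U_i$ and nonempty column sets $V_i$ such that * $\bigcup_{i} E_i=\hat E$, $\bigcup_i U_i=\{1,\dots,m\}$, $\bigcup_i V_i=\{1,\dots,n\}$, and $E_i\cap E_j=\emptyset$ whenever $j\ge i+2$; * for even $i$ with $1\le i\le l-2$: $U_i\cap U_{i+2}=U_{i+1}$, $V_i\subseteq V_{i+1}$ and $V_{i+2}\subseteq V_{i+1}$; * for odd $i$ with $1\le i\le l-2$: $V_i\cap V_{i+2}=V_{i+1}$, $U_i\subseteq U_{i+1}$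 and $U_{i+2}\subseteq U_{i+1}$; * if $l=2$: $U_1\subseteq U_2$ and $V_2\subseteq V_1$; * the bicliques containing any given row, or any given column, are consecutive in the chain: $U_i\cap U_k\subseteq U_j$ and $V_i\cap V_k\subseteq V_j$ for $i\le j\le k$. **Proposition.** There is a polynomial-time algorithm which, for sampling graphs with chain-clique structure, decides whether LRMC has a unique solution. Precisely: there are one program for the real random access machine (unit-cost field operations and comparisons on real numbers with $0$ and $1$ as the only real constants; unit-cost addition, truncated subtraction and comparison on natural numbers; indexed memory) and a polynomial $p$ with natural coefficients such that, for all $m,n$, every $\hat E$ with chain-clique structure and every $Z\in\mathbb R^{m\times n}$ of rank $r$, the program, given only $m,n,r$, the adjacency matrix of $\hat E$ and the sampled entries $z=\mathcal P_{\hat E}(Z)$, halts after at most $p(m+n)$ steps, and outputs $1$ if there is exactly one $M\in\mathbb R^{m\times n}$ with $\mathcal P_{\hat E}(M)=z$ and $\operatorname{rank}(M)\le r$, and $0$ otherwise. -/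

import Mathlib

namespace LRMC

/-! ### The low rank matrix completion problem -/

/-- The projection `P_E` of a real matrix onto the entries indexed by `E`. -/
def sample {m n : ℕ} (E : Finset (Fin m × Fin n)) (M : Matrix (Fin m) (Fin n) ℝ) :
    {e : Fin m × Fin n // e ∈ E} → ℝ :=
  fun e => M e.1.1 e.1.2

/-- `M` solves the completion problem with sampled positions `E`, data `z`, target rank `r`. -/
def IsSolution {m n : ℕ} (E : Finset (Fin m × Fin n))
    (z : {e : Fin m × Fin n // e ∈ E} → ℝ) (r : ℕ) (M : Matrix (Fin m) (Fin n) ℝ) : Prop :=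
  sample E M = z ∧ M.rank ≤ r

/-! ### Chains of bicliques -/

/-- The bicliques `U i × V i`, `1 ≤ i ≤ l`, form a chain (a "staircase") whose edges are `E`.
Only the values of `U` and `V` at `1, …, l` matter. -/
structure IsBicliqueChain {m n : ℕ} (E : Finset (Fin m × Fin n)) (l : ℕ)
    (U : ℕ → Finset (Fin m)) (V : ℕ → Finset (Fin n)) : Prop where
  one_le : 1 ≤ l
  rows_nonempty : ∀ i, 1 ≤ i → i ≤ l → (U i).Nonempty
  cols_nonempty : ∀ i, 1 ≤ i → i ≤ l → (V i).Nonempty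
  /-- the union of the edge sets is `E` -/
  edges : (Finset.Icc 1 l).biUnion (fun i => U i ×ˢ V i) = E
  /-- bicliques that are not neighbours in the chain share no edge -/
  edges_disjoint : ∀ i j, 1 ≤ i → i + 2 ≤ j → j ≤ l → Disjoint (U i ×ˢ V i) (U j ×ˢ V j)
  /-- the bicliques cover all the vertices -/
  rows_cover : (Finset.Icc 1 l).biUnion U = Finset.univ
  cols_cover : (Finset.Icc 1 l).biUnion V = Finset.univ
  even_step : ∀ i, 1 ≤ i → i + 2 ≤ l → Even i →
    U i ∩ U (i + 2) = U (i + 1) ∧ V i ∩ V (i + 1) = V i ∧ V (i + 2) ∩ V (i + 1) = V (i + 2)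
  odd_step : ∀ i, 1 ≤ i → i + 2 ≤ l → Odd i →
    V i ∩ V (i + 2) = V (i + 1) ∧ U i ∩ U (i + 1) = U i ∧ U (i + 2) ∩ U (i + 1) = U (i + 2)
  /-- the same nesting for a chain of only two bicliques, about which `odd_step` is silent -/
  two_step : l = 2 → U 1 ∩ U 2 = U 1 ∧ V 2 ∩ V 1 = V 2
  /-- the bicliques that contain a given row, or a given column, are consecutive in the chain -/
  rows_consecutive : ∀ i j k, 1 ≤ i → i ≤ j → j ≤ k → k ≤ l → U i ∩ U k ⊆ U j
  cols_consecutive : ∀ i j k, 1 ≤ i → i ≤ j → j ≤ k → k ≤ l → V i ∩ V k ⊆ V j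

/-- The pattern `E`, or its transpose, is a chain of bicliques: the first step of the staircase
may be a horizontal or a vertical one. -/
def HasChainStructure {m n : ℕ} (E : Finset (Fin m × Fin n)) : Prop :=
  ∃ (l : ℕ) (U : ℕ → Finset (Fin m)) (V : ℕ → Finset (Fin n)),
    IsBicliqueChain E l U V ∨ IsBicliqueChain (E.image Prod.swap) l V U

/-! ### Algorithms over the real numbers

A real random access machine, programmed by structured (`while`) programs.  The memory has integer
variables, integer arrays and real arrays (each array is two-dimensional and unbounded).  On
integers there are addition, truncated subtraction and comparison only; on reals there are the
field operations and comparison, with `0` and `1` as the only constants.  There is no conversion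
between the two.  Every evaluated operation or memory access costs one step. -/

/-- The memory. -/
structure State where
  ivar : ℕ → ℕ
  iarr : ℕ → ℕ → ℕ → ℕ
  rarr : ℕ → ℕ → ℕ → ℝ

/-- Integer expressions. -/
inductive IExp where
  | lit (c : ℕ)
  | var (x : ℕ)
  | get (k : ℕ) (i j : IExp)
  | add (a b : IExp)
  | sub (a b : IExp)

/-- Real expressions. -/
inductive RExp where
  | zero
  | one
  | get (k : ℕ) (i j : IExp)
  | add (a b : RExp)
  | sub (a b : RExp)
  | mul (a b : RExp)
  | div (a b : RExp)

/-- Tests. -/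
inductive BExp where
  | ieq (a b : IExp)
  | ilt (a b : IExp)
  | req (a b : RExp)
  | rlt (a b : RExp)
  | not (a : BExp)
  | and (a b : BExp)

/-- Programs. -/
inductive Prog where
  | skip
  | setVar (x : ℕ) (a : IExp)
  | setInt (k : ℕ) (i j : IExp) (a : IExp)
  | setReal (k : ℕ) (i j : IExp) (a : RExp)
  | seq (c d : Prog)
  | ite (b : BExp) (c d : Prog)
  | while (b : BExp) (c : Prog)

namespace IExp

def eval (s : State) : IExp → ℕ
  | lit c => c
  | var x => s.ivar x
  | get k i j => s.iarr k (i.eval s) (j.eval s)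
  | add a b => a.eval s + b.eval s
  | sub a b => a.eval s - b.eval s

def cost : IExp → ℕ
  | lit _ => 1
  | var _ => 1
  | get _ i j => i.cost + j.cost + 1
  | add a b => a.cost + b.cost + 1
  | sub a b => a.cost + b.cost + 1

end IExp

namespace RExp

noncomputable def eval (s : State) : RExp → ℝ
  | zero => 0
  | one => 1
  | get k i j => s.rarr k (i.eval s) (j.eval s)
  | add a b => a.eval s + b.eval s
  | sub a b => a.eval s - b.eval s
  | mul a b => a.eval s * b.eval s
  | div a b => a.eval s / b.eval s

def cost : RExp → ℕ
  | zero => 1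
  | one => 1
  | get _ i j => i.cost + j.cost + 1
  | add a b => a.cost + b.cost + 1
  | sub a b => a.cost + b.cost + 1
  | mul a b => a.cost + b.cost + 1
  | div a b => a.cost + b.cost + 1

end RExp

namespace BExp

def Holds (s : State) : BExp → Prop
  | ieq a b => a.eval s = b.eval s
  | ilt a b => a.eval s < b.eval s
  | req a b => a.eval s = b.eval s
  | rlt a b => a.eval s < b.eval s
  | not a => ¬ a.Holds s
  | and a b => a.Holds s ∧ b.Holds s

def cost : BExp → ℕ
  | ieq a b => a.cost + b.cost + 1
  | ilt a b => a.cost + b.cost + 1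
  | req a b => a.cost + b.cost + 1
  | rlt a b => a.cost + b.cost + 1
  | not a => a.cost + 1
  | and a b => a.cost + b.cost + 1

end BExp

namespace State

def setVar (s : State) (x v : ℕ) : State :=
  { s with ivar := Function.update s.ivar x v }

def setInt (s : State) (k i j v : ℕ) : State :=
  { s with iarr := fun k' i' j' => if k' = k ∧ i' = i ∧ j' = j then v else s.iarr k' i' j' }

noncomputable def setReal (s : State) (k i j : ℕ) (v : ℝ) : State :=
  { s with rarr := fun k' i' j' => if k' = k ∧ i' = i ∧ j' = j then v else s.rarr k' i' j' }

end State

/-- `Exec c s t s'`: the program `c`, started in memory `s`, halts after `t` steps with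
memory `s'`. -/
inductive Exec : Prog → State → ℕ → State → Prop
  | skip (s : State) : Exec .skip s 1 s
  | setVar (x : ℕ) (a : IExp) (s : State) :
      Exec (.setVar x a) s (a.cost + 1) (s.setVar x (a.eval s))
  | setInt (k : ℕ) (i j a : IExp) (s : State) :
      Exec (.setInt k i j a) s (i.cost + j.cost + a.cost + 1)
        (s.setInt k (i.eval s) (j.eval s) (a.eval s))
  | setReal (k : ℕ) (i j : IExp) (a : RExp) (s : State) :
      Exec (.setReal k i j a) s (i.cost + j.cost + a.cost + 1)
        (s.setReal k (i.eval s) (j.eval s) (a.eval s))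
  | seq {c d : Prog} {s s' s'' : State} {t t' : ℕ} :
      Exec c s t s' → Exec d s' t' s'' → Exec (.seq c d) s (t + t') s''
  | ite_true {b : BExp} {c d : Prog} {s s' : State} {t : ℕ} :
      b.Holds s → Exec c s t s' → Exec (.ite b c d) s (b.cost + t) s'
  | ite_false {b : BExp} {c d : Prog} {s s' : State} {t : ℕ} :
      ¬ b.Holds s → Exec d s t s' → Exec (.ite b c d) s (b.cost + t) s'
  | while_true {b : BExp} {c : Prog} {s s' s'' : State} {t t' : ℕ} :
      b.Holds s → Exec c s t s' → Exec (.while b c) s' t' s'' →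
      Exec (.while b c) s (b.cost + t + t') s''
  | while_false {b : BExp} {c : Prog} {s : State} :
      ¬ b.Holds s → Exec (.while b c) s b.cost s

/-- Programs are deterministic: the running time and the final memory are determined by the
program and the initial memory. -/
theorem Exec.deterministic {c : Prog} {s s₁ s₂ : State} {t₁ t₂ : ℕ}
    (h₁ : Exec c s t₁ s₁) (h₂ : Exec c s t₂ s₂) : t₁ = t₂ ∧ s₁ = s₂ := by
  induction h₁ generalizing t₂ s₂ with
  | skip s => cases h₂; exact ⟨rfl, rfl⟩
  | setVar x a s => cases h₂; exact ⟨rfl, rfl⟩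
  | setInt k i j a s => cases h₂; exact ⟨rfl, rfl⟩
  | setReal k i j a s => cases h₂; exact ⟨rfl, rfl⟩
  | seq _ _ ih ih' =>
    cases h₂ with
    | seq g g' =>
      obtain ⟨rfl, rfl⟩ := ih g
      obtain ⟨rfl, rfl⟩ := ih' g'
      exact ⟨rfl, rfl⟩
  | ite_true hb _ ih =>
    cases h₂ with
    | ite_true _ g => obtain ⟨rfl, rfl⟩ := ih g; exact ⟨rfl, rfl⟩
    | ite_false hb' _ => exact absurd hb hb'
  | ite_false hb _ ih =>
    cases h₂ with
    | ite_true hb' _ => exact absurd hb' hb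
    | ite_false _ g => obtain ⟨rfl, rfl⟩ := ih g; exact ⟨rfl, rfl⟩
  | while_true hb _ _ ih ih' =>
    cases h₂ with
    | while_true _ g g' =>
      obtain ⟨rfl, rfl⟩ := ih g
      obtain ⟨rfl, rfl⟩ := ih' g'
      exact ⟨rfl, rfl⟩
    | while_false hb' => exact absurd hb hb'
  | while_false hb =>
    cases h₂ with
    | while_true hb' _ _ => exact absurd hb' hb
    | while_false _ => exact ⟨rfl, rfl⟩

/-- The input: the integer variables `0, 1, 2` hold `m`, `n`, `r`; the integer array `0` is the
adjacency matrix of the sampling graph; the real array `0` holds the sampled entries, with `0` at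
the positions that are not sampled.  All other memory is zero. -/
noncomputable def input {m n : ℕ} (E : Finset (Fin m × Fin n))
    (z : {e : Fin m × Fin n // e ∈ E} → ℝ) (r : ℕ) : State where
  ivar := fun x => if x = 0 then m else if x = 1 then n else if x = 2 then r else 0
  iarr := fun k i j =>
    if ∃ (hi : i < m) (hj : j < n), k = 0 ∧ (⟨i, hi⟩, ⟨j, hj⟩) ∈ E then 1 else 0
  rarr := fun k i j =>
    if h : ∃ (hi : i < m) (hj : j < n), k = 0 ∧ (⟨i, hi⟩, ⟨j, hj⟩) ∈ E then
      z ⟨(⟨i, h.1⟩, ⟨j, h.2.1⟩), h.2.2.2⟩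
    else 0

end LRMC

/-! The algorithm never has to find the chain. For an unsampled position `(i, j)` take its corner:
the sampled entries lying in a row sampled in column `j` and in a column sampled in row `i`. On a
chain pattern the completion is unique if and only if every nonempty corner at an unsampled position
has rank `r` (`IsStaircase.rigid_iff`). This criterion involves only the pattern and the sampled
data, so it suffices to compute at most `m * n` ranks by elimination.

The combinatorial input is that rows and columns of a chain carry integer types, and adjacency
depends on the types alone (`IsStaircase`). Cutting the types at a suitable level leaves a single
block of sampled entries joining the two sides, and every nonempty corner at an unsampled position
is such a block, up to transposition.

Necessity: write `Z = P * Q` with inner dimension `r`. If the joining block has rank below `r`, then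
`P` restricted to its rows or `Q` restricted to its columns is degenerate. An invertible map `1 + w
vᵀ` applied to the factors on one side of the cut then leaves all sampled entries unchanged but
moves `Z`; if it moves nothing, a row of `P` can be changed freely
(`not_rigid_mul_of_vecMul_eq_zero`, `Rigid.rank_block_eq`).

Sufficiency: a block of rank `r` determines an entry from its row and column through the block
(`eq_of_rank_block`). Induction on the level of the types then forces every completion to equal `Z`
(`IsStaircase.agree_step`).

The remaining half is program verification: loop rules with explicit step counts, a pivot-by-pivot
rank computation (`runs_rankProg`, justified by `rank_deflate`), and a loop over all positions. -/

namespace LRMC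

set_option linter.unusedSectionVars false

open Matrix

/-! ### Rank factorizations -/

section Rank

variable {ι κ : Type*} [Fintype ι] [Fintype κ]

/-- A real matrix of rank `r` factors through `ℝ ^ r`. -/
theorem exists_rank_factorization (Z : Matrix ι κ ℝ) {r : ℕ} (hr : Z.rank = r) :
    ∃ (P : Matrix ι (Fin r) ℝ) (Q : Matrix (Fin r) κ ℝ), Z = P * Q := by
  classical
  let b : Module.Basis (Fin r) ℝ (LinearMap.range Z.mulVecLin) := Module.finBasisOfFinrankEq _ _ hr
  let col : κ → LinearMap.range Z.mulVecLin :=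
    fun j => ⟨Z.mulVecLin (Pi.single j 1), LinearMap.mem_range_self _ _⟩
  refine ⟨Matrix.of fun i a => (b a : ι → ℝ) i, Matrix.of fun a j => b.repr (col j) a, ?_⟩
  ext i j
  have h := congrArg (fun w : LinearMap.range Z.mulVecLin => (w : ι → ℝ) i) (b.sum_repr (col j))
  simp only [col, Submodule.coe_sum, Submodule.coe_smul, Finset.sum_apply, Pi.smul_apply,
    smul_eq_mul, mulVecLin_apply, mulVec_single_one, col_apply] at h
  simp only [mul_apply, of_apply]
  rw [← h]
  exact Finset.sum_congr rfl fun a _ => (mul_comm _ _).trans (by simp [col])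

theorem mulVec_injective_of_le_rank {r : ℕ} {A : Matrix ι (Fin r) ℝ} (h : r ≤ A.rank)
    {v : Fin r → ℝ} (hv : A *ᵥ v = 0) : v = 0 := by
  have h1 := A.mulVecLin.finrank_range_add_finrank_ker
  rw [Module.finrank_fin_fun] at h1
  have h2 : Module.finrank ℝ (LinearMap.ker A.mulVecLin) = 0 := by
    have : A.rank = Module.finrank ℝ (LinearMap.range A.mulVecLin) := rfl
    omega
  have h3 := Submodule.finrank_eq_zero.1 h2
  have : v ∈ LinearMap.ker A.mulVecLin := by simpa using hv
  rw [h3] at this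
  simpa using this

theorem vecMul_injective_of_le_rank {r : ℕ} {A : Matrix (Fin r) κ ℝ} (h : r ≤ A.rank)
    {v : Fin r → ℝ} (hv : v ᵥ* A = 0) : v = 0 := by
  rw [← rank_transpose] at h
  exact mulVec_injective_of_le_rank h (by rwa [mulVec_transpose])

theorem exists_mulVec_eq_of_le_rank {r : ℕ} {A : Matrix (Fin r) κ ℝ} (h : r ≤ A.rank)
    (w : Fin r → ℝ) : ∃ c, A *ᵥ c = w := by
  have : LinearMap.range A.mulVecLin = ⊤ := by
    apply Submodule.eq_top_of_finrank_eq
    rw [Module.finrank_fin_fun]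
    exact le_antisymm ((rank_le_card_height A).trans (by simp)) h
  obtain ⟨c, hc⟩ := LinearMap.range_eq_top.1 this w
  exact ⟨c, by simpa using hc⟩

theorem rank_mul_of_injective {r : ℕ} {A : Matrix ι (Fin r) ℝ} {B : Matrix (Fin r) κ ℝ}
    (hA : ∀ v, A *ᵥ v = 0 → v = 0) (hB : ∀ v, v ᵥ* B = 0 → v = 0) : (A * B).rank = r := by
  have hA' : Function.Injective A.mulVecLin :=
    (injective_iff_map_eq_zero A.mulVecLin).2 fun v hv => hA v (by simpa using hv)
  have hB' : Function.Injective Bᵀ.mulVecLin :=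
    (injective_iff_map_eq_zero Bᵀ.mulVecLin).2 fun v hv => hB v (by simpa [mulVec_transpose] using hv)
  have h1 : B.rank = r := by
    rw [← rank_transpose]
    exact (LinearMap.finrank_range_of_inj hB').trans (by simp)
  rw [Matrix.rank, mulVecLin_mul, LinearMap.range_comp]
  rw [← (Submodule.equivMapOfInjective _ hA' _).finrank_eq]
  exact h1

open Classical in
/-- The block of `Z` with rows in `X` and columns in `Y`, padded by zeros. -/
noncomputable def block (X : ι → Prop) (Y : κ → Prop) (Z : Matrix ι κ ℝ) : Matrix ι κ ℝ :=
  Matrix.of fun i j => if X i ∧ Y j then Z i j else 0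

open Classical in
theorem block_mul {r : ℕ} (X : ι → Prop) (Y : κ → Prop) (P : Matrix ι (Fin r) ℝ)
    (Q : Matrix (Fin r) κ ℝ) :
    block X Y (P * Q) = (Matrix.of fun i a => if X i then P i a else 0) *
      (Matrix.of fun a j => if Y j then Q a j else 0) := by
  ext i j
  by_cases hx : X i <;> by_cases hy : Y j <;> simp [block, mul_apply, hx, hy]

theorem rank_block_le (X : ι → Prop) (Y : κ → Prop) (Z : Matrix ι κ ℝ) :
    (block X Y Z).rank ≤ Z.rank := by
  classical
  have : block X Y Z = Matrix.diagonal (fun i => if X i then (1 : ℝ) else 0) *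
      (Z * Matrix.diagonal (fun j => if Y j then (1 : ℝ) else 0)) := by
    ext i j
    by_cases hx : X i <;> by_cases hy : Y j <;> simp [block, hx, hy]
  rw [this]
  exact (rank_mul_le_right _ _).trans (rank_mul_le_left _ _)

/-- A block that determines the row and the column space propagates equality of matrices. -/
theorem eq_of_rank_block {X : ι → Prop} {Y : κ → Prop} {M M' : Matrix ι κ ℝ} {r : ℕ}
    (hM : M.rank ≤ r) (hM' : M'.rank ≤ r) (hr : (block X Y M).rank = r)
    (hXY : ∀ x y, X x → Y y → M x y = M' x y) {i : ι} {j : κ}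
    (hi : ∀ y, Y y → M i y = M' i y) (hj : ∀ x, X x → M x j = M' x j) : M i j = M' i j := by
  classical
  have hr' : (block X Y M').rank = r := by
    rw [← hr]
    congr 1
    ext x y
    by_cases h : X x ∧ Y y
    · simp [block, h, hXY x y h.1 h.2]
    · simp [block, h]
  obtain ⟨P, Q, rfl⟩ := exists_rank_factorization M
    (le_antisymm hM (hr ▸ rank_block_le X Y M))
  obtain ⟨P', Q', rfl⟩ := exists_rank_factorization M'
    (le_antisymm hM' (hr' ▸ rank_block_le X Y M'))
  rw [block_mul] at hr hr'
  -- The columns of `Q` in `Y` span `ℝ ^ r`, so column `j` of `M` is a combination, with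
  -- coefficients `c`, of its columns in `Y`.
  obtain ⟨c, hc⟩ := exists_mulVec_eq_of_le_rank (hr ▸ rank_mul_le_right _ _) (fun a => Q a j)
  replace hc : ∀ a, Q a j = ∑ y, if Y y then Q a y * c y else 0 := fun a => by
    rw [← congrFun hc a]
    simp [mulVec, dotProduct]
  have key : ∀ i, (P * Q) i j = ∑ y, if Y y then (P * Q) i y * c y else 0 := fun i => by
    simp only [mul_apply, hc, Finset.mul_sum, Finset.sum_mul]
    rw [Finset.sum_comm]
    refine Finset.sum_congr rfl fun y _ => ?_
    split_ifs <;> simp [mul_assoc]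
  -- The same relation holds for `M'`: it holds in the rows of `X`, where the two matrices agree,
  -- and there the rows of `P'` separate vectors of `ℝ ^ r`. Row `i` then has equal data on `Y` in
  -- both matrices, hence equal entries at `j`.
  have h0 : (fun a => Q' a j - ∑ y, if Y y then Q' a y * c y else 0) = 0 := by
    apply mulVec_injective_of_le_rank (hr' ▸ rank_mul_le_left _ _)
    ext x
    by_cases hx : X x
    · have h1 : ∑ a, P' x a * Q' a j = ∑ y, if Y y then (∑ a, P' x a * Q' a y) * c y else 0 := by
        have h2 := key x
        rw [hj x hx] at h2
        rw [← mul_apply, h2]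
        refine Finset.sum_congr rfl fun y _ => ?_
        split_ifs with hy
        · rw [hXY x y hx hy, mul_apply]
        · rfl
      simp only [mulVec, dotProduct, of_apply, hx, if_true, mul_sub, Finset.sum_sub_distrib, h1,
        Finset.mul_sum, Pi.zero_apply, sub_eq_zero]
      rw [Finset.sum_comm (γ := Fin r)]
      refine Finset.sum_congr rfl fun y _ => ?_
      split_ifs <;> simp [mul_assoc, Finset.sum_mul]
    · simp [mulVec, dotProduct, hx]
  have h0' : ∀ a, Q' a j = ∑ y, if Y y then Q' a y * c y else 0 := fun a =>
    sub_eq_zero.1 (congrFun h0 a)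
  rw [key i]
  simp only [mul_apply (M := P'), h0', Finset.mul_sum]
  rw [Finset.sum_comm (γ := Fin r)]
  refine Finset.sum_congr rfl fun y _ => ?_
  split_ifs with hy
  · rw [hi y hy, mul_apply, Finset.sum_mul]
    exact Finset.sum_congr rfl fun a _ => by ring
  · simp

/-- Subtracting from `B` the rank one matrix spanned by the cross through a nonzero entry lowers
the rank by one. -/
theorem rank_deflate (B : Matrix ι κ ℝ) {p : ι} {q : κ} (h : B p q ≠ 0) :
    (Matrix.of fun x y => B x y - B x q * B p y / B p q).rank + 1 = B.rank := by
  classical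
  set B' : Matrix ι κ ℝ := Matrix.of fun x y => B x y - B x q * B p y / B p q with hB'
  apply le_antisymm
  · have h1 : B' = B * (1 - vecMulVec (Pi.single q 1) (fun y => B p y / B p q)) := by
      rw [Matrix.mul_sub, Matrix.mul_one, mul_vecMulVec, mulVec_single_one]
      ext x y
      simp [hB', vecMulVec_apply, mul_div_assoc]
    have hle : LinearMap.range B'.mulVecLin ≤ LinearMap.range B.mulVecLin := by
      rw [h1, mulVecLin_mul]
      exact LinearMap.range_comp_le_range _ _
    -- Row `p` of `B'` vanishes, while column `q` of `B` is nonzero at `p`; hence the inclusion of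
    -- column spaces is strict.
    have hp : ∀ w ∈ LinearMap.range B'.mulVecLin, w p = 0 := by
      rintro w ⟨v, rfl⟩
      simp [hB', mulVec, dotProduct, mul_div_cancel_left₀ _ h]
    have hlt : LinearMap.range B'.mulVecLin < LinearMap.range B.mulVecLin := by
      refine lt_of_le_of_ne hle fun heq => h ?_
      have : B.mulVecLin (Pi.single q 1) ∈ LinearMap.range B'.mulVecLin := heq ▸ ⟨_, rfl⟩
      simpa using hp _ this
    exact Submodule.finrank_lt_finrank_of_lt hlt
  · have h1 : B = B' + vecMulVec (fun x => B x q) (fun y => B p y / B p q) := by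
      ext x y
      simp [hB', vecMulVec_apply, mul_div_assoc]
    calc B.rank ≤ B'.rank + (vecMulVec (fun x => B x q) (fun y => B p y / B p q)).rank := by
          conv_lhs => rw [h1]
          rw [Matrix.rank, Matrix.rank, Matrix.rank, mulVecLin_add]
          exact (Submodule.finrank_mono (LinearMap.range_add_le _ _)).trans
            (Submodule.finrank_add_le_finrank_add_finrank _ _)
      _ ≤ B'.rank + 1 := Nat.add_le_add_left (rank_vecMulVec_le _ _) _

end Rank

/-! ### Perturbing a low rank matrix -/

section Rigid

variable {ι κ : Type*} [Fintype ι] [Fintype κ]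

/-- `Z` is the only matrix of rank at most `Z.rank` that agrees with `Z` on the pattern `E`. -/
def Rigid (E : ι → κ → Prop) (Z : Matrix ι κ ℝ) : Prop :=
  ∀ M : Matrix ι κ ℝ, (∀ i j, E i j → M i j = Z i j) → M.rank ≤ Z.rank → M = Z

theorem Rigid.transpose {E : ι → κ → Prop} {Z : Matrix ι κ ℝ} (h : Rigid E Z) :
    Rigid (fun j i => E i j) Zᵀ := by
  intro M hM hr
  rw [rank_transpose] at hr
  rw [← h Mᵀ (fun i j hij => hM j i hij) (by rwa [rank_transpose]), transpose_transpose]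

/-- If the pattern is split into a left and a right part, joined only in columns on which the
column factor of `Z` is degenerate, then the two parts can be moved against each other. -/
theorem not_rigid_mul_of_vecMul_eq_zero {E : ι → κ → Prop} {r : ℕ} {P : Matrix ι (Fin r) ℝ}
    {Q : Matrix (Fin r) κ ℝ} (hr : (P * Q).rank = r) {L : ι → Prop} {K : κ → Prop}
    {v : Fin r → ℝ} (hv : v ≠ 0)
    (hRL : ∀ i j, ¬ L i → K j → ¬ E i j)
    (hLR : ∀ i j, L i → ¬ K j → E i j → (v ᵥ* Q) j = 0)
    (hL : ∃ i, L i) (hR : ∃ i, ¬ L i) : ¬ Rigid E (P * Q) := by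
  classical
  intro hrig
  have hP : ∀ w, P *ᵥ w = 0 → w = 0 := fun w hw =>
    mulVec_injective_of_le_rank (hr.symm.le.trans (rank_mul_le_left _ _)) hw
  have hQ : ∀ w, w ᵥ* Q = 0 → w = 0 := fun w hw =>
    vecMul_injective_of_le_rank (hr.symm.le.trans (rank_mul_le_right _ _)) hw
  have hrig' : ∀ (P' : Matrix ι (Fin r) ℝ) (Q' : Matrix (Fin r) κ ℝ),
      (∀ i j, E i j → (P' * Q') i j = (P * Q) i j) → P' * Q' = P * Q := fun P' Q' h =>
    hrig _ h (by rw [hr]; exact (rank_mul_le_left _ _).trans (by simpa using rank_le_card_width P'))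
  -- Columns outside `K` are multiplied by `1 + w vᵀ`, and rows outside `L` by its inverse, given by
  -- the Sherman–Morrison formula. The two diagonal blocks of the product do not change, and the
  -- off-diagonal changes vanish on the pattern or miss it; rigidity forces them to vanish
  -- everywhere.
  have shift : ∀ w : Fin r → ℝ, 1 + v ⬝ᵥ w ≠ 0 → ∀ i j,
      (L i → ¬ K j → (P *ᵥ w) i * (v ᵥ* Q) j = 0) ∧
      (¬ L i → K j → (P *ᵥ w) i * (v ᵥ* Q) j = 0) := by
    intro w hw
    let P' : Matrix ι (Fin r) ℝ := Matrix.of fun i a =>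
      if L i then P i a else P i a - (P *ᵥ w) i / (1 + v ⬝ᵥ w) * v a
    let Q' : Matrix (Fin r) κ ℝ := Matrix.of fun a j =>
      if K j then Q a j else Q a j + w a * (v ᵥ* Q) j
    have hPw : ∀ i, ∑ a, P i a * w a = (P *ᵥ w) i := fun i => rfl
    have hvQ : ∀ j, ∑ a, v a * Q a j = (v ᵥ* Q) j := fun j => rfl
    have hvw : ∑ a, v a * w a = v ⬝ᵥ w := rfl
    have e : ∀ i j, (P' * Q') i j = (P * Q) i j +
        if L i then (if K j then 0 else (P *ᵥ w) i * (v ᵥ* Q) j)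
        else (if K j then - ((P *ᵥ w) i / (1 + v ⬝ᵥ w) * (v ᵥ* Q) j) else 0) := by
      intro i j
      by_cases hi : L i <;> by_cases hj : K j
      · simp [P', Q', mul_apply, hi, hj]
      · simp only [P', Q', mul_apply, of_apply, hi, hj, if_true, if_false, mul_add,
          Finset.sum_add_distrib, ← mul_assoc, ← Finset.sum_mul, hPw]
      · simp only [P', Q', mul_apply, of_apply, hi, hj, if_true, if_false, sub_mul,
          Finset.sum_sub_distrib, mul_assoc, ← Finset.mul_sum, hvQ]
        ring
      · simp only [P', Q', mul_apply, of_apply, hi, hj, if_false, mul_add, sub_mul,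
          Finset.sum_add_distrib, Finset.sum_sub_distrib]
        simp only [← mul_assoc, ← Finset.sum_mul, hPw]
        simp only [mul_assoc, ← Finset.mul_sum, hvQ]
        simp only [hvw]
        field_simp
        ring
    have h := hrig' P' Q' fun i j hE => by
      rw [e]
      by_cases hi : L i <;> by_cases hj : K j
      · simp [hi, hj]
      · simp [hi, hj, hLR i j hi hj hE]
      · exact absurd hE (hRL i j hi hj)
      · simp [hi, hj]
    intro i j
    have h' := e i j
    rw [h] at h'
    refine ⟨fun hi hj => ?_, fun hi hj => ?_⟩
    · simpa [hi, hj] using h'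
    · have h2 : (P *ᵥ w) i / (1 + v ⬝ᵥ w) * (v ᵥ* Q) j = 0 := by simpa [hi, hj] using h'
      rcases mul_eq_zero.1 h2 with h3 | h3
      · rw [(div_eq_zero_iff.1 h3).resolve_right hw, zero_mul]
      · rw [h3, mul_zero]
  have rowP : ∀ i j, ((L i ∧ ¬ K j) ∨ (¬ L i ∧ K j)) → (v ᵥ* Q) j ≠ 0 → P i = 0 := by
    intro i j hij hj
    -- Taking `w` parallel to `P i` makes the factor `(P *ᵥ w) i` a nonzero multiple of the squared
    -- norm of `P i`. One of the signs `1`, `-1` keeps `1 + v ⬝ᵥ w` nonzero.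
    have h1 : ∃ ε : ℝ, ε ≠ 0 ∧ 1 + v ⬝ᵥ (ε • P i) ≠ 0 := by
      by_cases h : 1 + v ⬝ᵥ P i = 0
      · refine ⟨-1, by norm_num, ?_⟩
        rw [dotProduct_smul, smul_eq_mul]
        intro h'
        linarith
      · exact ⟨1, one_ne_zero, by simpa using h⟩
    obtain ⟨ε, hε, h2⟩ := h1
    have h3 := shift _ h2 i j
    have h4 : (P *ᵥ (ε • P i)) i * (v ᵥ* Q) j = 0 := by
      rcases hij with ⟨a, b⟩ | ⟨a, b⟩
      · exact h3.1 a b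
      · exact h3.2 a b
    have h5 : (P *ᵥ (ε • P i)) i = ε * (P i ⬝ᵥ P i) := by
      rw [mulVec_smul]; rfl
    rw [h5] at h4
    have h6 := (mul_eq_zero.1 ((mul_eq_zero.1 h4).resolve_right hj)).resolve_left hε
    exact dotProduct_self_eq_zero.1 h6
  -- If row `i₀` is sampled only where `v ᵥ* Q` vanishes, adding `v` to that row of `P` is invisible
  -- on the pattern.
  have addRow : ∀ i₀, (∀ j, E i₀ j → (v ᵥ* Q) j = 0) → v ᵥ* Q = 0 := by
    intro i₀ h0
    let P' : Matrix ι (Fin r) ℝ := Matrix.of fun i a => if i = i₀ then P i a + v a else P i a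
    have e : ∀ i j, (P' * Q) i j = (P * Q) i j + if i = i₀ then (v ᵥ* Q) j else 0 := by
      intro i j
      by_cases hi : i = i₀
      · simp [P', mul_apply, hi, add_mul, Finset.sum_add_distrib, vecMul, dotProduct]
      · simp [P', mul_apply, hi]
    have h := hrig' P' Q fun i j hE => by
      rw [e]
      by_cases hi : i = i₀
      · subst hi
        simp [h0 j hE]
      · simp [hi]
    ext j
    have := e i₀ j
    rw [h] at this
    simpa using this
  have hvQ : v ᵥ* Q ≠ 0 := fun h => hv (hQ v h)
  obtain ⟨j, hj⟩ := Function.ne_iff.1 hvQ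
  have hPne : ∃ i, P i ≠ 0 := by
    by_contra! hcon
    refine hv (hP v ?_)
    ext i
    simp [mulVec, hcon i]
  obtain ⟨i₁, hi₁⟩ := hPne
  -- A column `j` with `(v ᵥ* Q) j ≠ 0` kills the rows of `P` on one side of the cut. The nonzero
  -- row `i₁` lies on the other side, so `v ᵥ* Q` vanishes on the columns off-diagonal to it, and
  -- `addRow` applies to any row on the killed side.
  by_cases hjK : K j
  · have h1 : ∀ i, ¬ L i → P i = 0 := fun i hi => rowP i j (Or.inr ⟨hi, hjK⟩) hj
    have hi₁L : L i₁ := by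
      by_contra h
      exact hi₁ (h1 _ h)
    obtain ⟨i₀, hi₀⟩ := hR
    refine hvQ (addRow i₀ fun j' hE => ?_)
    by_contra h
    exact hi₁ (rowP i₁ j' (Or.inl ⟨hi₁L, fun hK => hRL i₀ j' hi₀ hK hE⟩) h)
  · have h1 : ∀ i, L i → P i = 0 := fun i hi => rowP i j (Or.inl ⟨hi, hjK⟩) hj
    have hi₁L : ¬ L i₁ := fun h => hi₁ (h1 _ h)
    obtain ⟨i₀, hi₀⟩ := hL
    refine hvQ (addRow i₀ fun j' hE => ?_)
    by_cases hK : K j'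
    · by_contra h
      exact hi₁ (rowP i₁ j' (Or.inr ⟨hi₁L, hK⟩) h)
    · exact hLR i₀ j' hi₀ hK hE

/-- If a rigid pattern is split into a left and a right part that are joined in one block only,
then this block has full rank. -/
theorem Rigid.rank_block_eq {E : ι → κ → Prop} {Z : Matrix ι κ ℝ} (hrig : Rigid E Z)
    {L X : ι → Prop} {K Y : κ → Prop}
    (hRL : ∀ i j, ¬ L i → K j → ¬ E i j)
    (hLR : ∀ i j, L i → ¬ K j → E i j → X i ∧ Y j)
    (hL : ∃ i, L i) (hR : ∃ i, ¬ L i) (hK : ∃ j, K j) (hK' : ∃ j, ¬ K j) :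
    (block X Y Z).rank = Z.rank := by
  classical
  obtain ⟨P, Q, hPQ⟩ := exists_rank_factorization Z rfl
  have hr : (P * Q).rank = Z.rank := by rw [← hPQ]
  generalize Z.rank = r at P Q hPQ hr
  subst hPQ
  -- It suffices that both truncated factors are injective. A kernel vector of the column factor is
  -- excluded directly, one of the row factor after transposing and exchanging the sides of the cut.
  rw [block_mul]
  apply rank_mul_of_injective
  · intro w hw
    by_contra hne
    have hT : (P * Q)ᵀ = Qᵀ * Pᵀ := transpose_mul _ _
    have hrig' := hrig.transpose
    rw [hT] at hrig'
    refine not_rigid_mul_of_vecMul_eq_zero (L := fun j => ¬ K j) (K := fun i => ¬ L i)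
      (by rw [← hT, rank_transpose, hr]) hne ?_ ?_ hK' (by simpa using hK) hrig'
    · intro j i hj hi
      exact hRL i j hi (not_not.1 hj)
    · intro j i hj hi hE
      have hX := (hLR i j (not_not.1 hi) hj hE).1
      have := congrFun hw i
      simpa [vecMul_transpose, mulVec, hX] using this
  · intro v hv
    by_contra hne
    refine not_rigid_mul_of_vecMul_eq_zero hr hne hRL ?_ hL hR hrig
    intro i j hi hj hE
    have hY := (hLR i j hi hj hE).2
    have := congrFun hv j
    simpa [vecMul, hY] using this

end Rigid

/-! ### Staircase patterns -/

section Staircase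

variable {ι κ : Type*}

/-- The rows and columns carry types in `1, …, l`, and whether a position belongs to the pattern
`E` depends on the types only: row and column have equal types, or neighbouring types and the type
of the row has the parity opposite to `e`. -/
structure IsStaircase (E : ι → κ → Prop) (l e : ℕ) (τ : ι → ℕ) (σ : κ → ℕ) : Prop where
  row_mem : ∀ x, 1 ≤ τ x ∧ τ x ≤ l
  col_mem : ∀ y, 1 ≤ σ y ∧ σ y ≤ l
  iff : ∀ x y, E x y ↔
    τ x = σ y ∨ ((τ x + e) % 2 = 1 ∧ (σ y = τ x + 1 ∨ τ x = σ y + 1))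
  row_surj : ∀ k, 1 ≤ k → k ≤ l → (k + e) % 2 = 1 → ∃ x, τ x = k
  col_surj : ∀ k, 1 ≤ k → k ≤ l → (k + e) % 2 = 0 → ∃ y, σ y = k

/-- Neighbouring types have opposite parities, so exchanging rows and columns only shifts the parity
offset `e`. This lets each later argument treat one orientation only. -/
theorem IsStaircase.transpose {E : ι → κ → Prop} {l e : ℕ} {τ : ι → ℕ} {σ : κ → ℕ}
    (h : IsStaircase E l e τ σ) : IsStaircase (fun y x => E x y) l (e + 1) σ τ where
  row_mem := h.col_mem
  col_mem := h.row_mem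
  iff y x := by rw [h.iff]; omega
  row_surj k h1 h2 h3 := h.col_surj k h1 h2 (by omega)
  col_surj k h1 h2 h3 := h.row_surj k h1 h2 (by omega)

/-- Every element of a chain of sets, alternately increasing and decreasing, has a type. -/
theorem exists_type_of_chain {α : Type*} {l e : ℕ} {W : ℕ → Finset α}
    (hup : ∀ i, 1 ≤ i → i + 1 ≤ l → (i + e) % 2 = 1 → W i ⊆ W (i + 1))
    (hdown : ∀ i, 1 ≤ i → i + 1 ≤ l → (i + e) % 2 = 0 → W (i + 1) ⊆ W i)
    (hdisj : ∀ i, 1 ≤ i → i + 2 ≤ l → (i + e) % 2 = 1 → Disjoint (W i) (W (i + 2)))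
    (hcons : ∀ i j k, 1 ≤ i → i ≤ j → j ≤ k → k ≤ l → ∀ x, x ∈ W i → x ∈ W k → x ∈ W j)
    (hcover : ∀ x, ∃ i, 1 ≤ i ∧ i ≤ l ∧ x ∈ W i) (x : α) :
    ∃ t, (1 ≤ t ∧ t ≤ l) ∧ ∀ i, 1 ≤ i → i ≤ l →
      (x ∈ W i ↔ i = t ∨ ((t + e) % 2 = 1 ∧ (i = t + 1 ∨ t = i + 1))) := by
  -- Indices with `(i + e) % 2 = 1` carry the local minima of the chain. An element of such a `W t`
  -- takes type `t` and lies in `W t` and its existing neighbours; an element of no minimum lies in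
  -- exactly one set, whose index is its type.
  by_cases hodd : ∃ t, 1 ≤ t ∧ t ≤ l ∧ x ∈ W t ∧ (t + e) % 2 = 1
  · obtain ⟨t, ht1, ht2, hx, hpar⟩ := hodd
    refine ⟨t, ⟨ht1, ht2⟩, fun i hi1 hi2 => ⟨fun hxi => ?_, ?_⟩⟩
    · by_contra hcon
      rcases Nat.lt_or_ge i t with hlt | hge
      · have h1 := hcons i (t - 2) t hi1 (by omega) (by omega) ht2 x hxi hx
        have h2 := hdisj (t - 2) (by omega) (by omega) (by omega)
        rw [show t - 2 + 2 = t by omega] at h2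
        exact Finset.disjoint_left.1 h2 h1 hx
      · have h1 := hcons t (t + 2) i ht1 (by omega) (by omega) hi2 x hx hxi
        exact Finset.disjoint_left.1 (hdisj t ht1 (by omega) hpar) hx h1
    · rintro (rfl | ⟨-, rfl | rfl⟩)
      · exact hx
      · exact hup t ht1 hi2 hpar hx
      · exact hdown i hi1 ht2 (by omega) hx
  · push Not at hodd
    obtain ⟨t, ht1, ht2, hx⟩ := hcover x
    have hpar := hodd t ht1 ht2 hx
    refine ⟨t, ⟨ht1, ht2⟩, fun i hi1 hi2 => ⟨fun hxi => ?_, ?_⟩⟩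
    · have hpar' := hodd i hi1 hi2 hxi
      by_contra hcon
      rcases Nat.lt_or_ge i t with hlt | hge
      · exact hodd (t - 1) (by omega) (by omega)
          (hcons i (t - 1) t hi1 (by omega) (by omega) ht2 x hxi hx) (by omega)
      · exact hodd (t + 1) (by omega) (by omega)
          (hcons t (t + 1) i ht1 (by omega) (by omega) hi2 x hx hxi) (by omega)
    · rintro (rfl | ⟨h, -⟩)
      · exact hx
      · exact absurd h hpar

/-- The conditions on triples are turned into inclusions between consecutive bicliques. The last
pair of a longer chain is read off from the triple ending there; `two_step` is needed only when
there is no triple. -/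
theorem IsBicliqueChain.nesting {m n : ℕ} {E : Finset (Fin m × Fin n)} {l : ℕ}
    {U : ℕ → Finset (Fin m)} {V : ℕ → Finset (Fin n)} (h : IsBicliqueChain E l U V)
    {i : ℕ} (hi : 1 ≤ i) (hil : i + 1 ≤ l) :
    (i % 2 = 1 → U i ⊆ U (i + 1) ∧ V (i + 1) ⊆ V i) ∧
    (i % 2 = 0 → V i ⊆ V (i + 1) ∧ U (i + 1) ⊆ U i) := by
  constructor
  · intro hpar
    by_cases h2 : i + 2 ≤ l
    · obtain ⟨a, b, -⟩ := h.odd_step i hi h2 (Nat.odd_iff.2 hpar)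
      exact ⟨Finset.inter_eq_left.1 b, a ▸ Finset.inter_subset_left⟩
    · by_cases h1 : i = 1
      · subst h1
        obtain ⟨a, b⟩ := h.two_step (by omega)
        exact ⟨Finset.inter_eq_left.1 a, Finset.inter_eq_left.1 b⟩
      · obtain ⟨k, rfl⟩ : ∃ k, i = k + 1 := ⟨i - 1, by omega⟩
        obtain ⟨a, -, c⟩ := h.even_step k (by omega) (by omega) (Nat.even_iff.2 (by omega))
        exact ⟨a ▸ Finset.inter_subset_right, Finset.inter_eq_left.1 c⟩
  · intro hpar
    by_cases h2 : i + 2 ≤ l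
    · obtain ⟨a, b, -⟩ := h.even_step i hi h2 (Nat.even_iff.2 hpar)
      exact ⟨Finset.inter_eq_left.1 b, a ▸ Finset.inter_subset_left⟩
    · obtain ⟨k, rfl⟩ : ∃ k, i = k + 1 := ⟨i - 1, by omega⟩
      obtain ⟨a, -, c⟩ := h.odd_step k (by omega) (by omega) (Nat.odd_iff.2 (by omega))
      exact ⟨a ▸ Finset.inter_subset_right, Finset.inter_eq_left.1 c⟩

theorem IsBicliqueChain.exists_isStaircase {m n : ℕ} {E : Finset (Fin m × Fin n)} {l : ℕ}
    {U : ℕ → Finset (Fin m)} {V : ℕ → Finset (Fin n)} (h : IsBicliqueChain E l U V) :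
    ∃ τ σ, IsStaircase (fun x y => (x, y) ∈ E) l 0 τ σ := by
  have hU := exists_type_of_chain (l := l) (e := 0) (W := U)
    (fun i h1 h2 h3 => ((h.nesting h1 h2).1 h3).1)
    (fun i h1 h2 h3 => ((h.nesting h1 h2).2 h3).2)
    -- A row common to `U i` and `U (i + 2)`, joined to any column of `V (i + 1)`, would be an edge
    -- shared by two bicliques that are not neighbours.
    (fun i h1 h2 h3 => by
      obtain ⟨y, hy⟩ := h.cols_nonempty (i + 1) (by omega) (by omega)
      rw [Finset.disjoint_left]
      intro x hx hx'
      refine Finset.disjoint_left.1 (h.edges_disjoint i (i + 2) h1 le_rfl h2)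
        (Finset.mk_mem_product hx (((h.nesting h1 (by omega)).1 h3).2 hy))
        (Finset.mk_mem_product hx' ?_)
      exact ((h.nesting (i := i + 1) (by omega) h2).2 (by omega)).1 hy)
    (fun i j k h1 h2 h3 h4 x hx hx' =>
      h.rows_consecutive i j k h1 h2 h3 h4 (Finset.mem_inter.2 ⟨hx, hx'⟩))
    (fun x => by
      have := h.rows_cover.symm ▸ Finset.mem_univ x
      simpa [and_assoc] using this)
  have hV := exists_type_of_chain (l := l) (e := 1) (W := V)
    (fun i h1 h2 h3 => ((h.nesting h1 h2).2 (by omega)).1)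
    (fun i h1 h2 h3 => ((h.nesting h1 h2).1 (by omega)).2)
    (fun i h1 h2 h3 => by
      obtain ⟨x, hx⟩ := h.rows_nonempty (i + 1) (by omega) (by omega)
      rw [Finset.disjoint_left]
      intro y hy hy'
      refine Finset.disjoint_left.1 (h.edges_disjoint i (i + 2) h1 le_rfl h2)
        (Finset.mk_mem_product (((h.nesting h1 (by omega)).2 (by omega)).2 hx) hy)
        (Finset.mk_mem_product ?_ hy')
      exact ((h.nesting (i := i + 1) (by omega) h2).1 (by omega)).1 hx)
    (fun i j k h1 h2 h3 h4 x hx hx' =>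
      h.cols_consecutive i j k h1 h2 h3 h4 (Finset.mem_inter.2 ⟨hx, hx'⟩))
    (fun y => by
      have := h.cols_cover.symm ▸ Finset.mem_univ y
      simpa [and_assoc] using this)
  choose τ hτ hτ' using hU
  choose σ hσ hσ' using hV
  refine ⟨τ, σ, hτ, hσ, fun x y => ?_, fun k h1 h2 h3 => ?_, fun k h1 h2 h3 => ?_⟩
  · have hE : (x, y) ∈ E ↔ ∃ i, 1 ≤ i ∧ i ≤ l ∧ x ∈ U i ∧ y ∈ V i := by
      rw [← h.edges]
      simp [and_assoc]
    have hx := hτ x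
    have hy := hσ y
    rw [hE]
    constructor
    · rintro ⟨i, h1, h2, hxi, hyi⟩
      rw [hτ' x i h1 h2] at hxi
      rw [hσ' y i h1 h2] at hyi
      omega
    · intro hxy
      by_cases heq : τ x = σ y
      · refine ⟨τ x, hx.1, hx.2, (hτ' x _ hx.1 hx.2).2 (Or.inl rfl), ?_⟩
        rw [heq]
        exact (hσ' y _ hy.1 hy.2).2 (Or.inl rfl)
      · refine ⟨τ x, hx.1, hx.2, (hτ' x _ hx.1 hx.2).2 (Or.inl rfl), ?_⟩
        exact (hσ' y _ hx.1 hx.2).2 (by omega)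
  · obtain ⟨x, hx⟩ := h.rows_nonempty k h1 h2
    refine ⟨x, ?_⟩
    have := (hτ' x k h1 h2).1 hx
    omega
  · obtain ⟨y, hy⟩ := h.cols_nonempty k h1 h2
    refine ⟨y, ?_⟩
    have := (hσ' y k h1 h2).1 hy
    omega

theorem HasChainStructure.exists_isStaircase {m n : ℕ} {E : Finset (Fin m × Fin n)}
    (h : HasChainStructure E) :
    ∃ l e τ σ, IsStaircase (fun x y => (x, y) ∈ E) l e τ σ := by
  obtain ⟨l, U, V, h | h⟩ := h
  · obtain ⟨τ, σ, hE⟩ := h.exists_isStaircase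
    exact ⟨l, 0, τ, σ, hE⟩
  · obtain ⟨τ, σ, hE⟩ := h.exists_isStaircase
    exact ⟨l, 1, σ, τ, by simpa using hE.transpose⟩

end Staircase

/-! ### The rank criterion -/

section Criterion

variable {ι κ : Type*} [Fintype ι] [Fintype κ]

open Classical in
/-- The known entries of `Z` in the rows that are known in column `j` and the columns that are
known in row `i`, padded by zeros. -/
noncomputable def corner (E : ι → κ → Prop) (Z : Matrix ι κ ℝ) (i : ι) (j : κ) : Matrix ι κ ℝ :=
  Matrix.of fun x y => if E x j ∧ E i y ∧ E x y then Z x y else 0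

/-- Every corner of the pattern has full rank. -/
def FullCorners (E : ι → κ → Prop) (Z : Matrix ι κ ℝ) : Prop :=
  ∀ i j, ¬ E i j → (∃ x y, E x j ∧ E i y ∧ E x y) → (corner E Z i j).rank = Z.rank

theorem corner_transpose (E : ι → κ → Prop) (Z : Matrix ι κ ℝ) (i : ι) (j : κ) :
    corner (fun y x => E x y) Zᵀ j i = (corner E Z i j)ᵀ := by
  ext y x
  by_cases h : E x j ∧ E i y ∧ E x y
  · simp [corner, h]
  · have h' : ¬ (E i y ∧ E x j ∧ E x y) := by tauto
    simp [corner, h, h']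

theorem FullCorners.transpose {E : ι → κ → Prop} {Z : Matrix ι κ ℝ} (h : FullCorners E Z) :
    FullCorners (fun y x => E x y) Zᵀ := by
  rintro j i hij ⟨y, x, h1, h2, h3⟩
  rw [corner_transpose, rank_transpose, rank_transpose]
  exact h i j hij ⟨x, y, h2, h1, h3⟩

theorem corner_eq_block {E : ι → κ → Prop} {Z : Matrix ι κ ℝ} {i : ι} {j : κ} {X : ι → Prop}
    {Y : κ → Prop} (h : ∀ x y, E x j ∧ E i y ∧ E x y ↔ X x ∧ Y y) :
    corner E Z i j = block X Y Z := by
  ext x y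
  by_cases hxy : X x ∧ Y y
  · simp [corner, block, hxy, (h x y).2 hxy]
  · simp [corner, block, hxy, mt (h x y).1 hxy]

variable {E : ι → κ → Prop} {l e : ℕ} {τ : ι → ℕ} {σ : κ → ℕ} {Z : Matrix ι κ ℝ}

/-- Cutting the types between `k` and `k + 1`, with `k` of row parity, leaves only the joining block
of rows of type `k` and columns of type `k + 1`. For a suitable `k` between the types of `j` and
`i`, the corner is exactly this block. -/
theorem IsStaircase.rank_corner_of_lt (h : IsStaircase E l e τ σ) (hrig : Rigid E Z) {i : ι} {j : κ}
    (hij : ¬ E i j) (hlt : σ j < τ i) (hne : ∃ x y, E x j ∧ E i y ∧ E x y) :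
    (corner E Z i j).rank = Z.rank := by
  obtain ⟨x, y, h1, h2, h3⟩ := hne
  -- In the case of the wrong parity, `σ j + 1` is still below `τ i`: otherwise `(i, j)` would be
  -- sampled.
  obtain ⟨k, hk1, hk2, hk3⟩ : ∃ k, (k + e) % 2 = 1 ∧ σ j ≤ k ∧ k < τ i := by
    rw [h.iff] at hij
    by_cases hpar : (σ j + e) % 2 = 1
    · exact ⟨σ j, hpar, le_rfl, hlt⟩
    · exact ⟨σ j + 1, by omega, by omega, by omega⟩
  rw [h.iff] at h1 h2 h3
  rw [corner_eq_block (X := fun x => τ x = k) (Y := fun y => σ y = k + 1)]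
  · refine hrig.rank_block_eq (L := fun x => τ x ≤ k) (K := fun y => σ y ≤ k) ?_ ?_
      ⟨x, by omega⟩ ⟨i, by omega⟩ ⟨j, by omega⟩ ⟨y, by omega⟩
    · intro x' y' hx' hy' hE
      rw [h.iff] at hE
      omega
    · intro x' y' hx' hy' hE
      rw [h.iff] at hE
      omega
  · intro x' y'
    rw [h.iff, h.iff, h.iff]
    omega

theorem IsStaircase.fullCorners_of_rigid (h : IsStaircase E l e τ σ) (hrig : Rigid E Z) :
    FullCorners E Z := by
  intro i j hij hne
  rcases lt_trichotomy (σ j) (τ i) with hlt | heq | hgt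
  · exact h.rank_corner_of_lt hrig hij hlt hne
  · exact absurd ((h.iff i j).2 (Or.inl heq.symm)) hij
  · obtain ⟨x, y, h1, h2, h3⟩ := hne
    have := h.transpose.rank_corner_of_lt hrig.transpose (i := j) (j := i) hij hgt ⟨y, x, h2, h1, h3⟩
    rwa [corner_transpose, rank_transpose, rank_transpose] at this

/-- Passing from types up to `k` to types up to `k + 1`, the new unsampled positions have `τ i < k`,
`σ j = k + 1` or `τ i = k + 1`, `σ j ≤ k`. Each is determined by a block with row type `k`, the
column type being `k - 1` or `k + 1` respectively; the other data come from the pattern and the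
induction hypothesis. -/
theorem IsStaircase.agree_step (h : IsStaircase E l e τ σ) (hfull : FullCorners E Z)
    {M : Matrix ι κ ℝ} (hM : ∀ i j, E i j → M i j = Z i j) (hr : M.rank ≤ Z.rank) {k : ℕ}
    (hk : 1 ≤ k) (hkl : k + 1 ≤ l) (hpar : (k + e) % 2 = 1)
    (ih : ∀ i j, τ i ≤ k → σ j ≤ k → M i j = Z i j) (i : ι) (j : κ)
    (hi : τ i ≤ k + 1) (hj : σ j ≤ k + 1) : M i j = Z i j := by
  obtain ⟨x₀, hx₀⟩ := h.row_surj k hk (by omega) hpar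
  obtain ⟨y₀, hy₀⟩ := h.col_surj (k + 1) (by omega) hkl (by omega)
  have hτi := h.row_mem i
  have hσj := h.col_mem j
  by_cases hE : E i j
  · exact hM i j hE
  by_cases hih : τ i ≤ k ∧ σ j ≤ k
  · exact ih i j hih.1 hih.2
  rw [h.iff] at hE
  symm
  by_cases hik : τ i ≤ k
  · obtain ⟨hik', hjk⟩ : τ i < k ∧ σ j = k + 1 := by omega
    clear hE hih
    obtain ⟨y₁, hy₁⟩ := h.col_surj (k - 1) (by omega) (by omega) (by omega)
    -- The corner at `(i, j)` itself may be empty when `i` has a low type, so the row is replaced by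
    -- one of type `k - 2` or `k - 1`. For `k = 2` there is no type `k - 2`, but `i` has type `1`.
    obtain ⟨i', hi'⟩ : ∃ i', τ i' + 2 = k ∨ τ i' + 1 = k := by
      by_cases hk2 : k = 2
      · exact ⟨i, by omega⟩
      · obtain ⟨i', hi'⟩ := h.row_surj (k - 2) (by omega) (by omega) (by omega)
        exact ⟨i', by omega⟩
    have hrank := hfull i' j (by rw [h.iff]; omega)
      ⟨x₀, y₁, by rw [h.iff]; omega, by rw [h.iff]; omega, by rw [h.iff]; omega⟩
    rw [corner_eq_block (X := fun x => τ x = k) (Y := fun y => σ y + 1 = k)] at hrank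
    · refine eq_of_rank_block le_rfl hr hrank ?_ ?_ ?_
      · intro x y hx hy
        exact (hM x y (by rw [h.iff]; omega)).symm
      · intro y hy
        exact (ih i y hik (by omega)).symm
      · intro x hx
        exact (hM x j (by rw [h.iff]; omega)).symm
    · intro x y
      rw [h.iff, h.iff, h.iff]
      omega
  · obtain ⟨hik', hjk⟩ : τ i = k + 1 ∧ σ j ≤ k := by omega
    clear hE hih
    obtain ⟨j', hj'⟩ : ∃ j', σ j' + 1 = k ∨ σ j' = k := by
      by_cases hk1 : k = 1
      · exact ⟨j, by omega⟩
      · obtain ⟨j', hj'⟩ := h.col_surj (k - 1) (by omega) (by omega) (by omega)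
        exact ⟨j', by omega⟩
    have hrank := hfull i j' (by rw [h.iff]; omega)
      ⟨x₀, y₀, by rw [h.iff]; omega, by rw [h.iff]; omega, by rw [h.iff]; omega⟩
    rw [corner_eq_block (X := fun x => τ x = k) (Y := fun y => σ y = k + 1)] at hrank
    · refine eq_of_rank_block le_rfl hr hrank ?_ ?_ ?_
      · intro x y hx hy
        exact (hM x y (by rw [h.iff]; omega)).symm
      · intro y hy
        exact (hM i y (by rw [h.iff]; omega)).symm
      · intro x hx
        exact (ih x j (by omega) (by omega)).symm
    · intro x y
      rw [h.iff, h.iff, h.iff]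
      omega

/-- Induction on the level of the types. At level `1` every position is sampled; the steps at levels
of the other parity are `agree_step` for the transpose. -/
theorem IsStaircase.rigid_of_fullCorners (h : IsStaircase E l e τ σ) (hfull : FullCorners E Z) :
    Rigid E Z := by
  intro M hM hr
  have key : ∀ k ≤ l, ∀ i j, τ i ≤ k → σ j ≤ k → M i j = Z i j := by
    intro k
    induction k with
    | zero =>
      intro _ i j hi
      have := h.row_mem i
      omega
    | succ k ih =>
      intro hkl
      rcases Nat.eq_zero_or_pos k with rfl | hk
      · intro i j hi hj
        have h1 := h.row_mem i
        have h2 := h.col_mem j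
        exact hM i j (by rw [h.iff]; omega)
      · by_cases hpar : (k + e) % 2 = 1
        · exact h.agree_step hfull hM hr hk hkl hpar (ih (by omega))
        · intro i j hi hj
          exact h.transpose.agree_step hfull.transpose (M := Mᵀ) (fun j i hE => hM i j hE)
            (by rwa [rank_transpose, rank_transpose]) hk hkl (by omega)
            (fun j i hj hi => ih (by omega) i j hi hj) j i hj hi
  ext i j
  exact key l le_rfl i j (h.row_mem i).2 (h.col_mem j).2

/-- On a staircase pattern, the completion is unique if and only if all corners have full rank. -/
theorem IsStaircase.rigid_iff (h : IsStaircase E l e τ σ) : Rigid E Z ↔ FullCorners E Z :=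
  ⟨h.fullCorners_of_rigid, h.rigid_of_fullCorners⟩

theorem existsUnique_isSolution_iff {m n : ℕ} (E : Finset (Fin m × Fin n))
    (Z : Matrix (Fin m) (Fin n) ℝ) :
    (∃! M, IsSolution E (sample E Z) Z.rank M) ↔ Rigid (fun x y => (x, y) ∈ E) Z := by
  have hs : ∀ M, sample E M = sample E Z ↔ ∀ i j, (i, j) ∈ E → M i j = Z i j := fun M =>
    ⟨fun h i j hij => congrFun h ⟨(i, j), hij⟩, fun h => funext fun e => h _ _ e.2⟩
  constructor
  · rintro ⟨M₀, -, hM₀⟩ M hM hr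
    rw [hM₀ M ⟨(hs M).2 hM, hr⟩, hM₀ Z ⟨rfl, le_rfl⟩]
  · exact fun h => ⟨Z, ⟨rfl, le_rfl⟩, fun M hM => h M ((hs M).1 hM.1) hM.2⟩

end Criterion

/-! ### Total correctness with time bounds -/

/-- Started in memory `s`, the program `c` halts after at most `T` steps in a memory
satisfying `Q`. -/
def Runs (c : Prog) (s : State) (T : ℕ) (Q : State → Prop) : Prop :=
  ∃ t s', Exec c s t s' ∧ t ≤ T ∧ Q s'

namespace Runs

variable {c d : Prog} {s : State} {T T' : ℕ} {Q Q' : State → Prop}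

theorem mono (h : Runs c s T Q) (hT : T ≤ T') (hQ : ∀ s', Q s' → Q' s') : Runs c s T' Q' := by
  obtain ⟨t, s', h1, h2, h3⟩ := h
  exact ⟨t, s', h1, h2.trans hT, hQ _ h3⟩

theorem skip (h : Q s) : Runs .skip s 1 Q := ⟨1, s, .skip s, le_rfl, h⟩

theorem setVar {x : ℕ} {a : IExp} (h : Q (s.setVar x (a.eval s))) :
    Runs (.setVar x a) s (a.cost + 1) Q := ⟨_, _, .setVar x a s, le_rfl, h⟩

theorem setReal {k : ℕ} {i j : IExp} {a : RExp}
    (h : Q (s.setReal k (i.eval s) (j.eval s) (a.eval s))) :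
    Runs (.setReal k i j a) s (i.cost + j.cost + a.cost + 1) Q :=
  ⟨_, _, .setReal k i j a s, le_rfl, h⟩

theorem seq (h : Runs c s T fun s' => Runs d s' T' Q) : Runs (.seq c d) s (T + T') Q := by
  obtain ⟨t, s', h1, h2, t', s'', h3, h4, h5⟩ := h
  exact ⟨_, _, .seq h1 h3, Nat.add_le_add h2 h4, h5⟩

theorem ite {b : BExp} (h : b.Holds s → Runs c s T Q) (h' : ¬ b.Holds s → Runs d s T Q) :
    Runs (.ite b c d) s (b.cost + T) Q := by
  by_cases hb : b.Holds s
  · obtain ⟨t, s', h1, h2, h3⟩ := h hb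
    exact ⟨_, _, .ite_true hb h1, Nat.add_le_add_left h2 _, h3⟩
  · obtain ⟨t, s', h1, h2, h3⟩ := h' hb
    exact ⟨_, _, .ite_false hb h1, Nat.add_le_add_left h2 _, h3⟩

end Runs

/-- `for x = 0, …, (variable b) - 1 do c`. -/
def forLoop (x b : ℕ) (c : Prog) : Prog :=
  .seq (.setVar x (.lit 0))
    (.while (.ilt (.var x) (.var b)) (.seq c (.setVar x (.add (.var x) (.lit 1)))))

/-- In `T + 7`, the test costs `3` and the increment `4`; the final `5` pays for the initialization
and the failing test. The invariant must ignore the counter, and the body must leave it unchanged.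
-/
theorem Runs.forLoop {x b N T : ℕ} {c : Prog} {I : ℕ → State → Prop}
    (hb : ∀ k s, I k s → s.ivar b = N)
    (hx : ∀ k s v, I k s → I k (s.setVar x v))
    (hc : ∀ k < N, ∀ s, I k s → s.ivar x = k → Runs c s T fun s' => I (k + 1) s' ∧ s'.ivar x = k)
    {s : State} (h0 : I 0 s) : Runs (forLoop x b c) s (N * (T + 7) + 5) (I N) := by
  have key : ∀ d k s, k + d = N → I k s → s.ivar x = k →
      Runs (.while (.ilt (.var x) (.var b)) (.seq c (.setVar x (.add (.var x) (.lit 1))))) s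
        (d * (T + 7) + 3) (I N) := by
    intro d
    induction d with
    | zero =>
      intro k s hk hI hxk
      have hbN := hb k s hI
      obtain rfl : k = N := by omega
      refine ⟨_, s, .while_false ?_, ?_, hI⟩
      · simp [BExp.Holds, IExp.eval, hxk, hbN]
      · simp [BExp.cost, IExp.cost]
    | succ d ih =>
      intro k s hk hI hxk
      have hbN := hb k s hI
      obtain ⟨t, s', h1, h2, h3, h4⟩ := hc k (by omega) s hI hxk
      obtain ⟨t', s'', h5, h6, h7⟩ := ih (k + 1) (s'.setVar x (k + 1)) (by omega)
        (hx _ _ _ h3) (by simp [State.setVar])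
      have hinc := Exec.setVar x (.add (.var x) (.lit 1)) s'
      simp only [IExp.eval, h4] at hinc
      refine ⟨_, s'', .while_true ?_ (.seq h1 hinc) h5, ?_, h7⟩
      · simp only [BExp.Holds, IExp.eval, hxk, hbN]
        omega
      · simp only [BExp.cost, IExp.cost, Nat.succ_mul]
        omega
  refine (Runs.seq (T := 2) (T' := N * (T + 7) + 3) (Runs.setVar ?_)).mono (by omega) fun _ h => h
  exact key N 0 _ (by simp) (hx _ _ _ h0) (by simp [State.setVar, IExp.eval])

/-- The memory `s'` differs from `s` at most in the integer variables `vs` and the real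
arrays `ks`. -/
structure Frame (vs ks : Finset ℕ) (s s' : State) : Prop where
  ivar : ∀ v, v ∉ vs → s'.ivar v = s.ivar v
  iarr : s'.iarr = s.iarr
  rarr : ∀ k, k ∉ ks → s'.rarr k = s.rarr k

namespace Frame

variable {vs vs' ks ks' : Finset ℕ} {s s' s'' : State}

theorem refl (vs ks : Finset ℕ) (s : State) : Frame vs ks s s :=
  ⟨fun _ _ => rfl, rfl, fun _ _ => rfl⟩

theorem trans (h : Frame vs ks s s') (h' : Frame vs ks s' s'') : Frame vs ks s s'' :=
  ⟨fun v hv => (h'.ivar v hv).trans (h.ivar v hv), h'.iarr.trans h.iarr,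
    fun k hk => (h'.rarr k hk).trans (h.rarr k hk)⟩

theorem mono (h : Frame vs ks s s') (hv : vs ⊆ vs') (hk : ks ⊆ ks') : Frame vs' ks' s s' :=
  ⟨fun v hv' => h.ivar v fun h' => hv' (hv h'), h.iarr, fun k hk' => h.rarr k fun h' => hk' (hk h')⟩

theorem setVar (h : Frame vs ks s s') {x : ℕ} (hx : x ∈ vs) (a : ℕ) :
    Frame vs ks s (s'.setVar x a) :=
  ⟨fun v hv => by
    have : v ≠ x := fun e => hv (e ▸ hx)
    simp [State.setVar, this, h.ivar v hv], h.iarr, h.rarr⟩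

theorem setReal (h : Frame vs ks s s') {k : ℕ} (hk : k ∈ ks) (i j : ℕ) (a : ℝ) :
    Frame vs ks s (s'.setReal k i j a) :=
  ⟨h.ivar, h.iarr, fun k' hk' => by
    have : k' ≠ k := fun e => hk' (e ▸ hk)
    funext i' j'
    simp [State.setReal, this, h.rarr k' hk']⟩

end Frame

/-- A loop through the positions of an `m × n` matrix, row by row. -/
def matLoop (x y : ℕ) (c : Prog) : Prog := forLoop x 0 (forLoop y 1 c)

/-- A time bound for a loop through a matrix with at most `N` rows and columns. -/
def loopTime (N T : ℕ) : ℕ := N * (N * (T + 7) + 12) + 5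

/-- `(i, j)` precedes `(a, b)` in the row by row order. -/
def Before (a b i j : ℕ) : Prop := i < a ∨ i = a ∧ j < b

/-- The invariant is indexed by the next position to visit, `hrow` identifying the end of a row with
the start of the next. Variables `0` and `1` hold the loop bounds and must not be written. -/
theorem Runs.matLoop {x y m n T : ℕ} {c : Prog} {ws ks : Finset ℕ} {s₀ : State}
    {I : ℕ → ℕ → State → Prop} (hm : s₀.ivar 0 = m) (hn : s₀.ivar 1 = n)
    (h0 : 0 ∉ insert x (insert y ws)) (h1 : 1 ∉ insert x (insert y ws)) (hxy : x ≠ y)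
    (hx : x ∉ ws) (hy : y ∉ ws)
    (hIx : ∀ a b s v, I a b s → I a b (s.setVar x v))
    (hIy : ∀ a b s v, I a b s → I a b (s.setVar y v))
    (hrow : ∀ a s, I a n s → I (a + 1) 0 s)
    (hc : ∀ a < m, ∀ b < n, ∀ s, Frame (insert x (insert y ws)) ks s₀ s → I a b s →
      s.ivar x = a → s.ivar y = b → Runs c s T fun s' => Frame ws ks s s' ∧ I a (b + 1) s')
    (hI : I 0 0 s₀) :
    Runs (matLoop x y c) s₀ (loopTime (m + n) T)
      fun s' => Frame (insert x (insert y ws)) ks s₀ s' ∧ I m 0 s' := by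
  have hsub : ws ⊆ insert x (insert y ws) := fun v hv => by simp [hv]
  refine (Runs.forLoop (N := m) (T := n * (T + 7) + 5)
    (I := fun a s => Frame (insert x (insert y ws)) ks s₀ s ∧ I a 0 s) ?_ ?_ ?_
    ⟨Frame.refl _ _ _, hI⟩).mono ?_ fun _ h => h
  · exact fun a s h => (h.1.ivar 0 h0).trans hm
  · exact fun a s v h => ⟨h.1.setVar (by simp) _, hIx _ _ _ _ h.2⟩
  · intro a ha s hs hsx
    refine (Runs.forLoop (N := n) (T := T) (I := fun b s =>
      Frame (insert x (insert y ws)) ks s₀ s ∧ I a b s ∧ s.ivar x = a) ?_ ?_ ?_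
      ⟨hs.1, hs.2, hsx⟩).mono le_rfl fun s' h => ⟨⟨h.1, hrow _ _ h.2.1⟩, h.2.2⟩
    · exact fun a s h => (h.1.ivar 1 h1).trans hn
    · exact fun b s v h => ⟨h.1.setVar (by simp) _, hIy _ _ _ _ h.2.1, by
        simp [State.setVar, hxy, h.2.2]⟩
    · intro b hb s hs hsy
      refine (hc a ha b hb s hs.1 hs.2.1 hs.2.2 hsy).mono le_rfl fun s' h => ?_
      exact ⟨⟨hs.1.trans (h.1.mono hsub subset_rfl), h.2, (h.1.ivar x hx).trans hs.2.2⟩,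
        (h.1.ivar y hy).trans hsy⟩
  · unfold loopTime
    have h2 : n * (T + 7) ≤ (m + n) * (T + 7) := Nat.mul_le_mul_right _ (by omega)
    exact Nat.add_le_add_right (Nat.mul_le_mul (by omega) (by omega)) 5

/-- Assigning an expression to all the entries of a real array. -/
theorem Runs.mapLoop {k m n : ℕ} {e : RExp} {s₀ : State} {f : ℕ → ℕ → ℝ}
    (hm : s₀.ivar 0 = m) (hn : s₀.ivar 1 = n)
    (he : ∀ s, Frame {5, 6} {k} s₀ s → e.eval s = f (s.ivar 5) (s.ivar 6)) :
    Runs (LRMC.matLoop 5 6 (.setReal k (.var 5) (.var 6) e)) s₀ (loopTime (m + n) (e.cost + 3))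
      fun s' => Frame {5, 6} {k} s₀ s' ∧ ∀ x < m, ∀ y < n, s'.rarr k x y = f x y := by
  refine (Runs.matLoop (ws := ∅) (ks := {k}) (I := fun a b s => ∀ x y, y < n → Before a b x y →
    s.rarr k x y = f x y) hm hn (by decide) (by decide) (by decide) (by decide) (by decide)
    (fun _ _ _ _ h => h) (fun _ _ _ _ h => h) ?_ ?_ ?_).mono le_rfl fun s' h => ?_
  · intro a s h x y hy hxy
    refine h x y hy ?_
    unfold Before at *
    omega
  · intro a ha b hb s hF hI hsa hsb
    refine (Runs.setReal ?_).mono (by simp only [IExp.cost]; omega) fun _ h => h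
    refine ⟨(Frame.refl _ _ _).setReal (by simp) _ _ _, fun x y hy hxy => ?_⟩
    have hval := he s hF
    rw [hsa, hsb] at hval
    simp only [State.setReal, IExp.eval, hsa, hsb, hval, true_and]
    split_ifs with hab
    · rw [hab.1, hab.2]
    · refine hI x y hy ?_
      unfold Before at *
      omega
  · intro x y _ hxy
    unfold Before at hxy
    omega
  · exact ⟨h.1, fun x hx y hy => h.2 x y hy (Or.inl hx)⟩

/-! ### Computing the rank -/

/-- The upper left `m × n` part of an array. -/
def toMat (m n : ℕ) (f : ℕ → ℕ → ℝ) : Matrix (Fin m) (Fin n) ℝ := Matrix.of fun i j => f i j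

/-- Copies the array `1` to the array `2`, then subtracts from the array `1` the rank one matrix
through the entry at the position given by the variables `7` and `8`. -/
def deflateProg : Prog :=
  .seq (matLoop 5 6 (.setReal 2 (.var 5) (.var 6) (.get 1 (.var 5) (.var 6))))
    (matLoop 5 6 (.setReal 1 (.var 5) (.var 6)
      (.sub (.get 2 (.var 5) (.var 6))
        (.div (.mul (.get 2 (.var 5) (.var 8)) (.get 2 (.var 7) (.var 6)))
          (.get 2 (.var 7) (.var 8))))))

/-- The copy in array `2` is needed because row `p` and column `q` are overwritten while later
entries still require their old values. -/
theorem runs_deflateProg {m n p q : ℕ} {s : State} (hm : s.ivar 0 = m) (hn : s.ivar 1 = n)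
    (hp : s.ivar 7 = p) (hq : s.ivar 8 = q) (hpm : p < m) (hqn : q < n) :
    Runs deflateProg s (loopTime (m + n) 6 + loopTime (m + n) 18) fun s' =>
      Frame {5, 6} {1, 2} s s' ∧ ∀ x < m, ∀ y < n,
        s'.rarr 1 x y = s.rarr 1 x y - s.rarr 1 x q * s.rarr 1 p y / s.rarr 1 p q := by
  refine Runs.seq ((Runs.mapLoop (f := s.rarr 1) hm hn ?_).mono le_rfl fun s' h => ?_)
  · intro s' h
    simp [RExp.eval, IExp.eval, h.rarr 1 (by decide)]
  · obtain ⟨hF, hC⟩ := h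
    refine (Runs.mapLoop (f := fun x y => s'.rarr 2 x y - s'.rarr 2 x q * s'.rarr 2 p y /
      s'.rarr 2 p q) ((hF.ivar 0 (by decide)).trans hm) ((hF.ivar 1 (by decide)).trans hn)
      ?_).mono le_rfl fun s'' h => ⟨?_, ?_⟩
    · intro s'' h
      simp [RExp.eval, IExp.eval, h.rarr 2 (by decide), h.ivar 7 (by decide), h.ivar 8 (by decide),
        hF.ivar 7 (by decide), hF.ivar 8 (by decide), hp, hq]
    · exact (hF.mono subset_rfl (by decide)).trans (h.1.mono subset_rfl (by decide))
    · intro x hx y hy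
      rw [h.2 x hx y hy, hC x hx y hy, hC x hx q hqn, hC p hpm y hy, hC p hpm q hqn]

/-- Reduces the array `1` to zero and counts the reductions in the variable `9`. -/
def rankProg : Prog :=
  .seq (.setVar 9 (.lit 0))
    (matLoop 7 8 (.ite (.not (.req (.get 1 (.var 7) (.var 8)) .zero))
      (.seq (.setVar 9 (.add (.var 9) (.lit 1))) deflateProg) .skip))

/-- A time bound for `rankProg`. -/
def rankTime (N : ℕ) : ℕ := 2 + loopTime N (10 + loopTime N 6 + loopTime N 18)

/-- One pass suffices: a deflation at a nonzero `(a, b)` clears the whole row `a` and leaves the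
earlier rows zero. Each deflation lowers the rank by one, so counter plus remaining rank is
constant, and the pass ends with the zero matrix. -/
theorem runs_rankProg {m n : ℕ} {s : State} (hm : s.ivar 0 = m) (hn : s.ivar 1 = n) :
    Runs rankProg s (rankTime (m + n)) fun s' =>
      Frame {5, 6, 7, 8, 9} {1, 2} s s' ∧ s'.ivar 9 = (toMat m n (s.rarr 1)).rank := by
  refine Runs.seq (T := 2) (Runs.setVar ?_)
  set s₀ := s.setVar 9 ((IExp.lit 0).eval s) with hs₀
  have hF₀ : Frame {5, 6, 7, 8, 9} {1, 2} s s₀ := (Frame.refl _ _ _).setVar (by decide) _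
  refine (Runs.matLoop (m := m) (n := n) (ws := {5, 6, 9}) (ks := {1, 2})
    (I := fun a b s' => (∀ x < m, ∀ y < n, Before a b x y → s'.rarr 1 x y = 0) ∧
      s'.ivar 9 + (toMat m n (s'.rarr 1)).rank = (toMat m n (s.rarr 1)).rank)
    (by simp [hs₀, State.setVar, hm]) (by simp [hs₀, State.setVar, hn])
    (by decide) (by decide) (by decide) (by decide) (by decide) ?_ ?_ ?_ ?_ ?_).mono le_rfl
    fun s' h => ⟨hF₀.trans (h.1.mono (by decide) subset_rfl), ?_⟩
  · intro a b s' v h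
    exact ⟨h.1, by simpa [State.setVar] using h.2⟩
  · intro a b s' v h
    exact ⟨h.1, by simpa [State.setVar] using h.2⟩
  · rintro a s' ⟨h1, h2⟩
    refine ⟨fun x hx y hy hxy => h1 x hx y hy ?_, h2⟩
    unfold Before at *
    omega
  · rintro a ha b hb s' hF ⟨hz, hr⟩ hsa hsb
    refine (Runs.ite (T := 4 + (loopTime (m + n) 6 + loopTime (m + n) 18)) ?_ ?_).mono
      (by simp only [BExp.cost, RExp.cost, IExp.cost]; omega) fun _ h => h
    · intro hne
      simp only [BExp.Holds, RExp.eval, IExp.eval, hsa, hsb] at hne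
      refine Runs.seq (T := 4) (Runs.setVar ?_)
      set s₁ := s'.setVar 9 ((IExp.add (.var 9) (.lit 1)).eval s') with hs₁
      have h0 : s₁.ivar 0 = m := by
        simpa [hs₁, State.setVar, hs₀, hm] using hF.ivar 0 (by decide)
      have h1 : s₁.ivar 1 = n := by
        simpa [hs₁, State.setVar, hs₀, hn] using hF.ivar 1 (by decide)
      have hF₁ : Frame {5, 6, 9} {1, 2} s' s₁ := (Frame.refl _ _ _).setVar (by decide) _
      refine (runs_deflateProg h0 h1 (p := a) (q := b) (by simpa [hs₁, State.setVar] using hsa)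
        (by simpa [hs₁, State.setVar] using hsb) ha hb).mono le_rfl fun s₂ h =>
        ⟨hF₁.trans (h.1.mono (by decide) subset_rfl), ?_, ?_⟩
      · intro x hx y hy hxy
        have hrr : s₁.rarr = s'.rarr := rfl
        rw [h.2 x hx y hy, hrr]
        by_cases hxa : x = a
        · subst hxa
          rw [mul_div_cancel_left₀ _ hne, sub_self]
        · have hlt : x < a := by
            unfold Before at hxy
            omega
          rw [hz x hx y hy (Or.inl hlt), hz x hx b hb (Or.inl hlt)]
          simp
      · have h9 : s₂.ivar 9 = s'.ivar 9 + 1 := by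
          rw [h.1.ivar 9 (by decide)]
          simp [hs₁, State.setVar, IExp.eval]
        have hmat : toMat m n (s₂.rarr 1) = Matrix.of fun x y => toMat m n (s'.rarr 1) x y -
            toMat m n (s'.rarr 1) x ⟨b, hb⟩ * toMat m n (s'.rarr 1) ⟨a, ha⟩ y /
            toMat m n (s'.rarr 1) ⟨a, ha⟩ ⟨b, hb⟩ := by
          ext x y
          exact h.2 x x.2 y y.2
        have := rank_deflate (toMat m n (s'.rarr 1)) (p := ⟨a, ha⟩) (q := ⟨b, hb⟩) hne
        rw [h9, hmat, ← hr]
        omega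
    · intro hzero
      simp only [BExp.Holds, RExp.eval, IExp.eval, hsa, hsb, not_not] at hzero
      refine (Runs.skip ⟨Frame.refl _ _ _, fun x hx y hy hxy => ?_, hr⟩).mono (by omega)
        fun _ h => h
      by_cases hab : x = a ∧ y = b
      · rw [hab.1, hab.2, hzero]
      · refine hz x hx y hy ?_
        unfold Before at *
        omega
  · refine ⟨fun x hx y hy hxy => ?_, by simp [hs₀, State.setVar, IExp.eval]⟩
    unfold Before at hxy
    omega
  · have h0 : toMat m n (s'.rarr 1) = 0 := by
      ext x y
      exact h.2.1 x x.2 y y.2 (Or.inl x.2)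
    have := h.2.2
    rwa [h0, Matrix.rank_zero, add_zero] at this

/-! ### The decision procedure -/

/-- The position `(x, y)` lies in the corner at `(i, j)` of the pattern with adjacency
matrix `A`. -/
def InCorner (A : ℕ → ℕ → ℕ) (i j x y : ℕ) : Prop := A x j = 1 ∧ A i y = 1 ∧ A x y = 1

/-- Writes the corner at the position given by the variables `3` and `4` into the array `1`, and
records in the variable `10` whether it is nonempty. -/
def cornerProg : Prog :=
  .seq (.setVar 10 (.lit 0))
    (matLoop 5 6 (.ite (.and (.ieq (.get 0 (.var 5) (.var 4)) (.lit 1))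
        (.and (.ieq (.get 0 (.var 3) (.var 6)) (.lit 1))
          (.ieq (.get 0 (.var 5) (.var 6)) (.lit 1))))
      (.seq (.setVar 10 (.lit 1)) (.setReal 1 (.var 5) (.var 6) (.get 0 (.var 5) (.var 6))))
      (.setReal 1 (.var 5) (.var 6) .zero)))

open Classical in
theorem runs_cornerProg {m n i j : ℕ} {s : State} {A : ℕ → ℕ → ℕ} (hm : s.ivar 0 = m)
    (hn : s.ivar 1 = n) (hi : s.ivar 3 = i) (hj : s.ivar 4 = j) (hA : s.iarr 0 = A) :
    Runs cornerProg s (2 + loopTime (m + n) 25) fun s' => Frame {5, 6, 10} {1} s s' ∧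
      (∀ x < m, ∀ y < n, s'.rarr 1 x y = if InCorner A i j x y then s.rarr 0 x y else 0) ∧
      (s'.ivar 10 = 1 ↔ ∃ x < m, ∃ y < n, InCorner A i j x y) := by
  refine Runs.seq (T := 2) (Runs.setVar ?_)
  set s₀ := s.setVar 10 ((IExp.lit 0).eval s) with hs₀
  have hF₀ : Frame {5, 6, 10} {1} s s₀ := (Frame.refl _ _ _).setVar (by decide) _
  refine (Runs.matLoop (m := m) (n := n) (ws := {10}) (ks := {1})
    (I := fun a b s' => (∀ x < m, ∀ y < n, Before a b x y →
        s'.rarr 1 x y = if InCorner A i j x y then s.rarr 0 x y else 0) ∧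
      (s'.ivar 10 = 1 ↔ ∃ x < m, ∃ y < n, Before a b x y ∧ InCorner A i j x y))
    ((hF₀.ivar 0 (by decide)).trans hm) ((hF₀.ivar 1 (by decide)).trans hn)
    (by decide) (by decide) (by decide) (by decide) (by decide) ?_ ?_ ?_ ?_ ?_).mono le_rfl
    fun s' h => ⟨hF₀.trans (h.1.mono (by decide) subset_rfl), ?_, ?_⟩
  · intro a b s' v h
    exact ⟨h.1, by simpa [State.setVar] using h.2⟩
  · intro a b s' v h
    exact ⟨h.1, by simpa [State.setVar] using h.2⟩
  · rintro a s' ⟨h1, h2⟩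
    have hB : ∀ x, ∀ y < n, Before (a + 1) 0 x y ↔ Before a n x y := fun x y hy => by
      unfold Before
      omega
    refine ⟨fun x hx y hy hxy => h1 x hx y hy ((hB x y hy).1 hxy), h2.trans ?_⟩
    constructor
    · rintro ⟨x, hx, y, hy, h3, h4⟩
      exact ⟨x, hx, y, hy, (hB x y hy).2 h3, h4⟩
    · rintro ⟨x, hx, y, hy, h3, h4⟩
      exact ⟨x, hx, y, hy, (hB x y hy).1 h3, h4⟩
  · rintro a ha b hb s' hF ⟨h1, h2⟩ hsa hsb
    have hF' := hF₀.trans (hF.mono (by decide) subset_rfl)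
    have hB : ∀ x y, Before a (b + 1) x y ↔ Before a b x y ∨ (x = a ∧ y = b) := fun x y => by
      unfold Before
      omega
    have hz : s'.rarr 0 = s.rarr 0 := hF'.rarr 0 (by decide)
    refine (Runs.ite (T := 8) ?_ ?_).mono (by simp only [BExp.cost, IExp.cost]; omega) fun _ h => h
    · intro hcor
      simp only [BExp.Holds, IExp.eval, hsa, hsb, hF'.iarr, hA, hF'.ivar 3 (by decide),
        hF'.ivar 4 (by decide), hi, hj] at hcor
      refine Runs.seq (T := 2) (T' := 6) (Runs.setVar (Runs.setReal
        ⟨((Frame.refl _ _ _).setVar (by decide) _).setReal (by decide) _ _ _,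
          fun x hx y hy hxy => ?_, ?_⟩))
      · rw [hB] at hxy
        by_cases hab : x = a ∧ y = b
        · have : InCorner A i j a b := hcor
          simp [State.setReal, State.setVar, IExp.eval, RExp.eval, hsa, hsb, hab, this, hz]
        · have := h1 x hx y hy (hxy.resolve_right hab)
          simpa [State.setReal, State.setVar, IExp.eval, hsa, hsb, hab] using this
      · simp only [State.setReal, State.setVar, IExp.eval, Function.update_self, true_iff]
        exact ⟨a, ha, b, hb, (hB a b).2 (Or.inr ⟨rfl, rfl⟩), hcor⟩
    · intro hcor
      simp only [BExp.Holds, IExp.eval, hsa, hsb, hF'.iarr, hA, hF'.ivar 3 (by decide),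
        hF'.ivar 4 (by decide), hi, hj] at hcor
      refine (Runs.setReal ⟨(Frame.refl _ _ _).setReal (by decide) _ _ _,
        fun x hx y hy hxy => ?_, ?_⟩).mono (by simp only [IExp.cost, RExp.cost]; omega) fun _ h => h
      · rw [hB] at hxy
        by_cases hab : x = a ∧ y = b
        · have : ¬ InCorner A i j a b := hcor
          simp [State.setReal, IExp.eval, RExp.eval, hsa, hsb, hab, this]
        · have := h1 x hx y hy (hxy.resolve_right hab)
          simpa [State.setReal, IExp.eval, hsa, hsb, hab] using this
      · refine h2.trans ⟨?_, ?_⟩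
        · rintro ⟨x, hx, y, hy, h3, h4⟩
          exact ⟨x, hx, y, hy, (hB x y).2 (Or.inl h3), h4⟩
        · rintro ⟨x, hx, y, hy, h3, h4⟩
          rcases (hB x y).1 h3 with h5 | ⟨rfl, rfl⟩
          · exact ⟨x, hx, y, hy, h5, h4⟩
          · exact absurd h4 hcor
  · refine ⟨fun x hx y hy hxy => ?_, ?_⟩
    · unfold Before at hxy
      omega
    · simp [hs₀, State.setVar, IExp.eval, Before]
  · exact fun x hx y hy => h.2.1 x hx y hy (Or.inl hx)
  · refine h.2.2.trans ⟨?_, ?_⟩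
    · rintro ⟨x, hx, y, hy, -, h4⟩
      exact ⟨x, hx, y, hy, h4⟩
    · rintro ⟨x, hx, y, hy, h4⟩
      exact ⟨x, hx, y, hy, Or.inl hx, h4⟩

open Classical in
/-- The corner at `(i, j)` of an array, padded by zeros. -/
noncomputable def cornerArr (A : ℕ → ℕ → ℕ) (z : ℕ → ℕ → ℝ) (i j : ℕ) : ℕ → ℕ → ℝ :=
  fun x y => if InCorner A i j x y then z x y else 0

/-- The position `(i, j)` is known, or its corner is empty or of rank `r`. -/
def GoodPosition (A : ℕ → ℕ → ℕ) (z : ℕ → ℕ → ℝ) (m n r i j : ℕ) : Prop :=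
  A i j = 0 → (∃ x < m, ∃ y < n, InCorner A i j x y) → (toMat m n (cornerArr A z i j)).rank = r

/-- Clears the variable `11` if the position given by the variables `3` and `4` is not good. -/
def positionProg : Prog :=
  .ite (.ieq (.get 0 (.var 3) (.var 4)) (.lit 0))
    (.seq cornerProg (.seq rankProg
      (.ite (.and (.ieq (.var 10) (.lit 1)) (.not (.ieq (.var 9) (.var 2))))
        (.setVar 11 (.lit 0)) .skip)))
    .skip

/-- A time bound for `positionProg`. -/
def positionTime (N : ℕ) : ℕ := 18 + loopTime N 25 + rankTime N

theorem runs_positionProg {m n r i j : ℕ} {s : State} {A : ℕ → ℕ → ℕ} {z : ℕ → ℕ → ℝ}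
    (hm : s.ivar 0 = m) (hn : s.ivar 1 = n) (hr : s.ivar 2 = r) (hi : s.ivar 3 = i)
    (hj : s.ivar 4 = j) (hA : s.iarr 0 = A) (hz : s.rarr 0 = z) :
    Runs positionProg s (positionTime (m + n)) fun s' =>
      Frame {5, 6, 7, 8, 9, 10, 11} {1, 2} s s' ∧
      (GoodPosition A z m n r i j → s'.ivar 11 = s.ivar 11) ∧
      (¬ GoodPosition A z m n r i j → s'.ivar 11 = 0) := by
  refine (Runs.ite (T := 2 + loopTime (m + n) 25 + (rankTime (m + n) + (8 + 2))) ?_ ?_).mono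
    (by simp only [BExp.cost, IExp.cost, positionTime]; omega) fun _ h => h
  · intro h0
    simp only [BExp.Holds, IExp.eval, hi, hj, hA] at h0
    refine Runs.seq ((runs_cornerProg hm hn hi hj hA).mono le_rfl ?_)
    rintro s₁ ⟨hF₁, hB, h10⟩
    refine Runs.seq ((runs_rankProg ((hF₁.ivar 0 (by decide)).trans hm)
      ((hF₁.ivar 1 (by decide)).trans hn)).mono le_rfl ?_)
    rintro s₂ ⟨hF₂, h9⟩
    have hF : Frame {5, 6, 7, 8, 9, 10, 11} {1, 2} s s₂ :=
      (hF₁.mono (by decide) (by decide)).trans (hF₂.mono (by decide) (by decide))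
    have hmat : toMat m n (s₁.rarr 1) = toMat m n (cornerArr A z i j) := by
      ext x y
      rw [← hz]
      exact hB x x.2 y y.2
    rw [hmat] at h9
    have h11 : s₂.ivar 11 = s.ivar 11 := by
      rw [hF₂.ivar 11 (by decide), hF₁.ivar 11 (by decide)]
    -- At an unsampled position, being bad means precisely that the corner is nonempty and its
    -- computed rank differs from `r`.
    have htest : (BExp.and (.ieq (.var 10) (.lit 1)) (.not (.ieq (.var 9) (.var 2)))).Holds s₂ ↔
        ¬ GoodPosition A z m n r i j := by
      simp only [BExp.Holds, IExp.eval, h9, hF₂.ivar 10 (by decide), h10, hF.ivar 2 (by decide), hr,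
        GoodPosition, h0, true_imp_iff, Classical.not_imp]
    refine (Runs.ite (T := 2) (fun hb => ?_) fun hb => ?_).mono
      (by simp only [BExp.cost, IExp.cost]; omega) fun _ h => h
    · refine Runs.setVar ⟨hF.setVar (by decide) _, fun hg => absurd hg (htest.1 hb), fun _ => ?_⟩
      simp [State.setVar, IExp.eval]
    · rw [htest, not_not] at hb
      exact (Runs.skip ⟨hF, fun _ => h11, fun hg => absurd hb hg⟩).mono (by omega) fun _ h => h
  · intro h0
    simp only [BExp.Holds, IExp.eval, hi, hj, hA] at h0
    exact (Runs.skip ⟨Frame.refl _ _ _, fun _ => rfl, fun hg => absurd (fun h => absurd h h0) hg⟩).mono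
      (by omega) fun _ h => h

/-- The decision procedure: are all the positions good? -/
def decideProg : Prog :=
  .seq (.setVar 11 (.lit 1)) (.seq (matLoop 3 4 positionProg) (.setVar 0 (.var 11)))

theorem runs_decideProg {m n r : ℕ} {s : State} {A : ℕ → ℕ → ℕ} {z : ℕ → ℕ → ℝ}
    (hm : s.ivar 0 = m) (hn : s.ivar 1 = n) (hr : s.ivar 2 = r) (hA : s.iarr 0 = A)
    (hz : s.rarr 0 = z) :
    Runs decideProg s (4 + loopTime (m + n) (positionTime (m + n))) fun s' =>
      (s'.ivar 0 = 0 ∨ s'.ivar 0 = 1) ∧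
      (s'.ivar 0 = 1 ↔ ∀ i < m, ∀ j < n, GoodPosition A z m n r i j) := by
  refine (Runs.seq (T := 2) (T' := loopTime (m + n) (positionTime (m + n)) + 2)
    (Runs.setVar ?_)).mono (by omega) fun _ h => h
  set s₀ := s.setVar 11 ((IExp.lit 1).eval s) with hs₀
  have hF₀ : Frame {3, 4, 5, 6, 7, 8, 9, 10, 11} {1, 2} s s₀ :=
    (Frame.refl _ _ _).setVar (by decide) _
  refine Runs.seq ((Runs.matLoop (m := m) (n := n) (ws := {5, 6, 7, 8, 9, 10, 11}) (ks := {1, 2})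
    (I := fun a b s' => (s'.ivar 11 = 0 ∨ s'.ivar 11 = 1) ∧
      (s'.ivar 11 = 1 ↔ ∀ i < m, ∀ j < n, Before a b i j → GoodPosition A z m n r i j))
    ((hF₀.ivar 0 (by decide)).trans hm) ((hF₀.ivar 1 (by decide)).trans hn)
    (by decide) (by decide) (by decide) (by decide) (by decide) ?_ ?_ ?_ ?_ ?_).mono le_rfl ?_)
  · intro a b s' v h
    simpa [State.setVar] using h
  · intro a b s' v h
    simpa [State.setVar] using h
  · rintro a s' ⟨h1, h2⟩
    have hB : ∀ x, ∀ y < n, Before (a + 1) 0 x y ↔ Before a n x y := fun x y hy => by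
      unfold Before
      omega
    exact ⟨h1, h2.trans ⟨fun h i hi j hj hij => h i hi j hj ((hB i j hj).1 hij),
      fun h i hi j hj hij => h i hi j hj ((hB i j hj).2 hij)⟩⟩
  · rintro a ha b hb s' hF ⟨h1, h2⟩ hsa hsb
    have hF' := hF₀.trans (hF.mono (by decide) subset_rfl)
    have hB : ∀ x y, Before a (b + 1) x y ↔ Before a b x y ∨ (x = a ∧ y = b) := fun x y => by
      unfold Before
      omega
    refine (runs_positionProg (A := A) (z := z) ((hF'.ivar 0 (by decide)).trans hm)
      ((hF'.ivar 1 (by decide)).trans hn) ((hF'.ivar 2 (by decide)).trans hr) hsa hsb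
      (by rw [hF'.iarr, hA]) ((hF'.rarr 0 (by decide)).trans hz)).mono le_rfl ?_
    rintro s'' ⟨hF'', hgood, hbad⟩
    refine ⟨hF'', ?_⟩
    by_cases hg : GoodPosition A z m n r a b
    · rw [hgood hg]
      refine ⟨h1, h2.trans ⟨fun h i hi j hj hij => ?_,
        fun h i hi j hj hij => h i hi j hj ((hB i j).2 (Or.inl hij))⟩⟩
      rcases (hB i j).1 hij with h' | ⟨rfl, rfl⟩
      · exact h i hi j hj h'
      · exact hg
    · rw [hbad hg]
      refine ⟨Or.inl rfl, ⟨fun h => absurd h zero_ne_one, fun h => absurd ?_ hg⟩⟩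
      exact h a ha b hb ((hB a b).2 (Or.inr ⟨rfl, rfl⟩))
  · simp [hs₀, State.setVar, IExp.eval, Before]
  · rintro s' ⟨-, h1, h2⟩
    refine Runs.setVar ?_
    simp only [State.setVar, IExp.eval, Function.update_self]
    exact ⟨h1, h2.trans ⟨fun h i hi j hj => h i hi j hj (Or.inl hi),
      fun h i hi j hj _ => h i hi j hj⟩⟩

/-- This links the program to the criterion: a corner uses sampled entries only, so it can be read
off from the input arrays, and its rank is that of the corner of `Z`. -/
theorem forall_goodPosition_iff {m n : ℕ} (E : Finset (Fin m × Fin n))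
    (Z : Matrix (Fin m) (Fin n) ℝ) :
    (∀ i < m, ∀ j < n, GoodPosition ((input E (sample E Z) Z.rank).iarr 0)
      ((input E (sample E Z) Z.rank).rarr 0) m n Z.rank i j) ↔
      FullCorners (fun x y => (x, y) ∈ E) Z := by
  set A := (input E (sample E Z) Z.rank).iarr 0 with hA
  set z := (input E (sample E Z) Z.rank).rarr 0 with hz
  have hA1 : ∀ (x : Fin m) (y : Fin n), A x y = 1 ↔ (x, y) ∈ E := fun x y => by
    simp [hA, input]
  have hA0 : ∀ (x : Fin m) (y : Fin n), A x y = 0 ↔ (x, y) ∉ E := fun x y => by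
    simp [hA, input]
  have hzE : ∀ (x : Fin m) (y : Fin n), (x, y) ∈ E → z x y = Z x y := fun x y hxy => by
    simp [hz, input, hxy, sample]
  have hcor : ∀ (i : Fin m) (j : Fin n) (x : Fin m) (y : Fin n),
      InCorner A i j x y ↔ (x, j) ∈ E ∧ (i, y) ∈ E ∧ (x, y) ∈ E := fun i j x y => by
    simp only [InCorner, hA1]
  have hmat : ∀ (i : Fin m) (j : Fin n),
      toMat m n (cornerArr A z i j) = corner (fun x y => (x, y) ∈ E) Z i j := fun i j => by
    ext x y
    by_cases h : (x, j) ∈ E ∧ (i, y) ∈ E ∧ (x, y) ∈ E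
    · simp [toMat, cornerArr, corner, hcor, h, hzE]
    · simp only [toMat, cornerArr, corner, hcor, h, Matrix.of_apply, if_false]
  have hiff : ∀ (i : Fin m) (j : Fin n), GoodPosition A z m n Z.rank i j ↔ ((i, j) ∉ E →
      (∃ x y, (x, j) ∈ E ∧ (i, y) ∈ E ∧ (x, y) ∈ E) →
        (corner (fun x y => (x, y) ∈ E) Z i j).rank = Z.rank) := fun i j => by
    have hex : (∃ x < m, ∃ y < n, InCorner A i j x y) ↔
        ∃ x y, (x, j) ∈ E ∧ (i, y) ∈ E ∧ (x, y) ∈ E := by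
      constructor
      · rintro ⟨x, hx, y, hy, h⟩
        exact ⟨⟨x, hx⟩, ⟨y, hy⟩, (hcor i j ⟨x, hx⟩ ⟨y, hy⟩).1 h⟩
      · rintro ⟨x, y, h⟩
        exact ⟨x, x.2, y, y.2, (hcor i j x y).2 h⟩
    rw [GoodPosition, hA0, hex, hmat]
  exact ⟨fun h i j => (hiff i j).1 (h i i.2 j j.2),
    fun h i hi j hj => (hiff ⟨i, hi⟩ ⟨j, hj⟩).2 (h ⟨i, hi⟩ ⟨j, hj⟩)⟩

open Polynomial in
/-- The polynomial behind `loopTime`. -/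
noncomputable def loopPoly (p : ℕ[X]) : ℕ[X] := X * (X * (p + 7) + 12) + 5

theorem eval_loopPoly (p : Polynomial ℕ) (N : ℕ) :
    (loopPoly p).eval N = loopTime N (p.eval N) := by
  simp [loopPoly, loopTime]

end LRMC

theorem mainTheorem10 :
    ∃ (c : LRMC.Prog) (p : Polynomial ℕ),
      ∀ (m n : ℕ) (E : Finset (Fin m × Fin n)) (Z : Matrix (Fin m) (Fin n) ℝ),
        LRMC.HasChainStructure E →
        ∃ (t : ℕ) (s : LRMC.State),
          LRMC.Exec c (LRMC.input E (LRMC.sample E Z) Z.rank) t s ∧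
          t ≤ p.eval (m + n) ∧
          (s.ivar 0 = 0 ∨ s.ivar 0 = 1) ∧
          (s.ivar 0 = 1 ↔ ∃! M : Matrix (Fin m) (Fin n) ℝ,
            LRMC.IsSolution E (LRMC.sample E Z) Z.rank M) := by
  open LRMC in
  -- The polynomial repeats the nesting of the loops: all positions outside, then corner
  -- construction (`25`) and rank computation, with the two deflation passes (`6` and `18`)
  -- innermost.
  refine ⟨decideProg, 4 + loopPoly (18 + loopPoly 25 +
    (2 + loopPoly (10 + loopPoly 6 + loopPoly 18))), fun m n E Z hE => ?_⟩
  obtain ⟨l, e, τ, σ, hS⟩ := hE.exists_isStaircase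
  obtain ⟨t, s, h1, h2, h3, h4⟩ := runs_decideProg (s := input E (sample E Z) Z.rank)
    (m := m) (n := n) (r := Z.rank) rfl rfl rfl rfl rfl
  refine ⟨t, s, h1, h2.trans (le_of_eq ?_), h3, ?_⟩
  · simp [eval_loopPoly, positionTime, rankTime]
  · rw [h4, forall_goodPosition_iff, ← hS.rigid_iff, existsUnique_isSolution_iff]
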